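/- **Setting.** For each $d\in\mathbb N$ let $\Omega_d$ be a separable metric space with metric $\rho$ and a Borel probability measure $\mu_d$. The concentration function of $\Omega_d$ is $\alpha_{\Omega_d}(0)=\frac12$ and $$\alpha_{\Omega_d}(\varepsilon)=1-\inf\{\mu_d(A_\varepsilon): A\subseteq\Omega_d \text{ measurable},\ \mu_d(A)\ge \tfrac12\}\quad(\varepsilon>0),\qquad A_\varepsilon=\{x:\rho(x,A)<\varepsilon\}.$$ For a class $\mathscr F$ of real functions, $\mathscr F_{\ge}$ is the family of all sets $\{\omega: f(\omega)\ge a\}$, $f\in\mathscr F$, $a\in\mathbb R$, and $\mathrm{VC\text{-}dim}$ is the supremum of the cardinalities of shattered sets. A *metric tree* on $\Omega$ with decision functions in a class $\mathscr F$ of 1-Lipschitz functions $\Omega\to\mathbb R$ is a finite rooted binary tree with a set $B_t\subseteq\Omega$ for every node $t$ (for a leaf, its bin) and a function $f_t\in\mathscr F$ for every inner node $t$, such that $B_{\mathrm{root}}=\Omega$ and, for every inner node $t$ with children $t_-,t_+$, one has $B_t\subseteq B_{t_-}\cup B_{t_+}$, $f_t\le 0$ on $B_{t_-}$ and $f_t\ge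 0$ on $B_{t_+}$. A range query with centre $\omega$ and radius $\varepsilon$ accesses the root and, from every accessed inner node $t$, the child $t_-$ iff $f_t(\omega)<\varepsilon$ and the child $t_+$ iff $f_t(\omega)>-\varepsilon$. Its cost for a finite dataset $X\subseteq\Omega$ is the number of accessed nodes plus the sum of $|X\cap B_t|$ over the accessed leaves $t$. The cost of the exact nearest neighbour search at $\omega$ is the cost of the range query of radius $\varepsilon_{NN}(\omega)=\min_{x\in X}\rho(\omega,x)$ (any larger radius costs at least as much). The expected average cost of the tree is the expectation of this cost over $\omega\sim\mu_d$. **Theorem.** Assume: 1. there are constants $C$ and $c>0$ such that, for all sufficiently large $d$, $\alpha_{\Omega_d}(\varepsilon)\le C\exp(-c\,\varepsilon^2 d)$ for all $\varepsilon\ge 0$; 2. for all sufficiently large $d$, the expected distance between two independent points is $\mathbb E_{\mu_d\otimes\mu_d}\,\rho(x,y)=1$; 3. $\mathscr F_d$ is a class of 1-Lipschitz functions $\Omega_d\to\mathbb R$ with $\mathrm{VC\text{-}dim}((\mathscr F_d)_{\ge})=d^{O(1)}$, that is, there is $k$ with $\mathrm{VC\text{-}dim}((\mathscr F_d)_{\ge})\le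 d^k$ for all sufficiently large $d$; 4. $n=n_d$ satisfies $d=n^{o(1)}$, that is, for every $k$ one has $n_d\ge d^k$ for all sufficiently large $d$, and $d=\omega(\log n)$, that is, $\log n_d=o(d)$. Let $X_d$ consist of $n_d$ i.i.d. points of $\Omega_d$ with distribution $\mu_d$, sampled independently for different $d$. Then there is a function $h:\mathbb N\to\mathbb N$ with $h(d)\to\infty$ such that, with confidence tending to $1$ as $d\to\infty$, every metric tree on $\Omega_d$ with decision functions in $\mathscr F_d$ (the tree may depend on $X_d$) has expected average exact nearest neighbour search cost at least $d^{h(d)}$ for the dataset $X_d$. Moreover, for almost every infinite sample path $(X_d)_{d\in\mathbb N}$ this holds for all sufficiently large $d$. (Here "with confidence tending to $1$" means that the outer probability of the set of samples for which the claim fails tends to $0$.) -/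

import Mathlib

open MeasureTheory Filter Topology Set
open scoped ENNReal

noncomputable section

namespace SimSearch

/-- The concentration function of a metric space with a probability measure:
`α(0) = 1/2`, and for `ε > 0` it is `1 - inf μ(A_ε)` over all measurable sets `A` of measure at
least `1/2`, where `A_ε = {x | d(x, A) < ε}` is the open `ε`-neighbourhood. -/
def concentrationFunction {Ω : Type*} [MetricSpace Ω] [MeasurableSpace Ω]
    (μ : Measure Ω) (ε : ℝ) : ℝ :=
  if ε = 0 then 1 / 2
  else 1 - sInf ((fun A : Set Ω => μ.real (Metric.thickening ε A)) ''
    {A : Set Ω | MeasurableSet A ∧ 1 / 2 ≤ μ.real A})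

/-- `B` is shattered by the family `𝒜`: every subset of `B` is a trace of a member of `𝒜`. -/
def Shatters {Ω : Type*} (𝒜 : Set (Set Ω)) (B : Set Ω) : Prop :=
  ∀ C ⊆ B, ∃ A ∈ 𝒜, A ∩ B = C

/-- The Vapnik-Chervonenkis dimension: the supremum of the cardinalities of shattered sets
(`⊤` if it is infinite). -/
def vcDim {Ω : Type*} (𝒜 : Set (Set Ω)) : ℕ∞ :=
  ⨆ (B : Set Ω) (_ : Shatters 𝒜 B), B.encard

/-- The family of all superlevel sets `{ω | a ≤ f ω}`, `f ∈ F`, `a ∈ ℝ`. -/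
def superlevelSets {Ω : Type*} (F : Set (Ω → ℝ)) : Set (Set Ω) :=
  {S | ∃ f ∈ F, ∃ a : ℝ, S = {ω | a ≤ f ω}}

/-- A finite rooted binary tree in which every node `t` carries a block `B_t ⊆ Ω` (for a leaf,
its bin), and every inner node carries also a decision function and its two children
`t₋` (first) and `t₊` (second). -/
inductive IndexTree (Ω : Type*) where
  | leaf (B : Set Ω) : IndexTree Ω
  | node (B : Set Ω) (f : Ω → ℝ) (tneg tpos : IndexTree Ω) : IndexTree Ω

namespace IndexTree

variable {Ω : Type*}

/-- The block `B_t` at the root of a tree. -/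
def block : IndexTree Ω → Set Ω
  | leaf B => B
  | node B _ _ _ => B

/-- The conditions at the inner nodes of a metric tree with decision functions in `F`:
`f_t ∈ F` is 1-Lipschitz, `B_t ⊆ B_{t₋} ∪ B_{t₊}`, `f_t ≤ 0` on `B_{t₋}`, and `f_t ≥ 0` on
`B_{t₊}`. -/
def Admissible [MetricSpace Ω] (F : Set (Ω → ℝ)) : IndexTree Ω → Prop
  | leaf _ => True
  | node B f tneg tpos =>
      f ∈ F ∧ LipschitzWith 1 f ∧ B ⊆ tneg.block ∪ tpos.block ∧
      (∀ ω ∈ tneg.block, f ω ≤ 0) ∧ (∀ ω ∈ tpos.block, 0 ≤ f ω) ∧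
      tneg.Admissible F ∧ tpos.Admissible F

/-- A metric tree on `Ω` with decision functions in `F`; the block of its root is all of `Ω`. -/
def IsMetricTree [MetricSpace Ω] (F : Set (Ω → ℝ)) (T : IndexTree Ω) : Prop :=
  T.block = Set.univ ∧ T.Admissible F

open Classical in
/-- The number of operations for the range query with centre `ω` and radius `ε` in the dataset
`X`: one for every accessed node, and one for every datapoint in the bin of an accessed leaf.
The root is accessed; from an accessed inner node `t`, the child `t₋` is accessed iff
`f_t ω < ε`, and the child `t₊` iff `-ε < f_t ω`. -/
def rangeCost (X : Set Ω) (ω : Ω) (ε : ℝ) : IndexTree Ω → ℕ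
  | leaf B => 1 + (X ∩ B).ncard
  | node _ f tneg tpos =>
      1 + (if f ω < ε then tneg.rangeCost X ω ε else 0)
        + (if -ε < f ω then tpos.rangeCost X ω ε else 0)

/-- The cost of the exact nearest neighbour search at `ω`: the range query whose radius is the
distance from `ω` to the nearest datapoint. The cost of a range query is nondecreasing in the
radius, so every range query with a larger radius costs at least as much. -/
def nnCost [MetricSpace Ω] (X : Set Ω) (T : IndexTree Ω) (ω : Ω) : ℕ :=
  T.rangeCost X ω (Metric.infDist ω X)

/-- The expected cost of the exact nearest neighbour search for a query point `ω ∼ μ`. -/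
def avgNNCost [MetricSpace Ω] [MeasurableSpace Ω] (μ : Measure Ω) (X : Set Ω)
    (T : IndexTree Ω) : ℝ≥0∞ :=
  ∫⁻ ω, (T.nnCost X ω : ℝ≥0∞) ∂μ

end IndexTree

end SimSearch

end

/-!
A cell is the set of points satisfying the sign conditions on the path from the root to a node. A
query which is closer than its radius to the cell of a node accesses this node.

Concentration and the lower bound on the mean distance force every ball of some fixed radius `ε` to
have exponentially small measure. As `n` is subexponential in `d`, all but a small proportion of the
queries are farther than `ε` from the dataset, so that their radius is at least `ε`. Again by
concentration, a cell which is not itself exponentially small has an `ε`-neighbourhood of almost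
full measure, so that its node is accessed by at least half of the queries.

Let `Q` and `p` be powers of `d`. The cells down to depth `2 * Q` have only polynomially large VC
dimension, so symmetrization shows, with high probability for all trees at once, that every such
cell with more than `p` data points is not exponentially small. A tree of mean cost less than `Q`
therefore has at most `2 * Q` of these crowded cells, and following the points down the tree bounds
their number by about `2 * p * Q`. This is impossible because `n` is superpolynomial in `d`.

The failure probability is at most `1 / d ^ 2`, which is summable, and a diagonal argument lets the
exponent of `Q` grow with `d`.
-/

namespace SimSearch

section Concentration

variable {Ω : Type*} [MetricSpace Ω] [MeasurableSpace Ω] {μ : Measure Ω}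

theorem one_sub_concentrationFunction_le_measureReal_thickening {δ : ℝ} (hδ : 0 < δ) {A : Set Ω}
    (hA : MeasurableSet A) (hμA : 1 / 2 ≤ μ.real A) :
    1 - concentrationFunction μ δ ≤ μ.real (Metric.thickening δ A) := by
  rw [concentrationFunction, if_neg hδ.ne', sub_sub_cancel]
  exact csInf_le ⟨0, by rintro _ ⟨B, -, rfl⟩; exact measureReal_nonneg⟩ ⟨A, ⟨hA, hμA⟩, rfl⟩

variable [OpensMeasurableSpace Ω] [IsProbabilityMeasure μ]

theorem half_le_measureReal_thickening_of_concentrationFunction_lt {δ : ℝ} (hδ : 0 < δ) {A : Set Ω}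
    (hA : concentrationFunction μ δ < μ.real A) : 1 / 2 ≤ μ.real (Metric.thickening δ A) := by
  by_contra! hlt
  have hmeas : MeasurableSet (Metric.thickening δ A) := Metric.isOpen_thickening.measurableSet
  have hcompl : 1 / 2 ≤ μ.real (Metric.thickening δ A)ᶜ := by
    rw [probReal_compl_eq_one_sub hmeas]
    linarith
  have hmeas' : MeasurableSet (Metric.thickening δ (Metric.thickening δ A)ᶜ) :=
    Metric.isOpen_thickening.measurableSet
  have hsub : A ⊆ (Metric.thickening δ (Metric.thickening δ A)ᶜ)ᶜ := by
    intro x hxA hx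
    obtain ⟨y, hy, hxy⟩ := Metric.mem_thickening_iff.1 hx
    exact hy (Metric.mem_thickening_iff.2 ⟨x, hxA, by rwa [dist_comm]⟩)
  have hle := measureReal_mono (μ := μ) hsub
  rw [probReal_compl_eq_one_sub hmeas'] at hle
  linarith [one_sub_concentrationFunction_le_measureReal_thickening hδ hmeas.compl hcompl]

theorem one_sub_concentrationFunction_le_measureReal_thickening_two_mul {δ : ℝ} (hδ : 0 < δ)
    {A : Set Ω} (hA : concentrationFunction μ δ < μ.real A) :
    1 - concentrationFunction μ δ ≤ μ.real (Metric.thickening (2 * δ) A) :=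
  (one_sub_concentrationFunction_le_measureReal_thickening hδ Metric.isOpen_thickening.measurableSet
    (half_le_measureReal_thickening_of_concentrationFunction_lt hδ hA)).trans
    (measureReal_mono ((Metric.thickening_thickening_subset δ δ A).trans_eq (by rw [two_mul])))

theorem measureReal_le_dist_le_concentrationFunction {ω : Ω} {r t : ℝ} (ht : 0 < t)
    (hr : 1 / 2 ≤ μ.real (Metric.ball ω r)) :
    μ.real {x | r + t ≤ dist ω x} ≤ concentrationFunction μ t := by
  have hsub : {x | r + t ≤ dist ω x} ⊆ (Metric.thickening t (Metric.ball ω r))ᶜ := by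
    intro x hx hxt
    obtain ⟨y, hy, hxy⟩ := Metric.mem_thickening_iff.1 hxt
    have hx : r + t ≤ dist ω x := hx
    linarith [dist_triangle_right ω x y, Metric.mem_ball'.1 hy]
  have hle := measureReal_mono (μ := μ) hsub
  rw [probReal_compl_eq_one_sub Metric.isOpen_thickening.measurableSet] at hle
  linarith [one_sub_concentrationFunction_le_measureReal_thickening ht
    Metric.isOpen_ball.measurableSet hr]

theorem lintegral_edist_le_of_half_le_measureReal_ball {ω : Ω} {r : ℝ}
    (hr : 1 / 2 ≤ μ.real (Metric.ball ω r)) :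
    ∫⁻ x, edist ω x ∂μ ≤
      ENNReal.ofReal r + ∫⁻ t in Ioi 0, ENNReal.ofReal (concentrationFunction μ t) := by
  have hcont : Continuous fun x => max (dist ω x - r) 0 := by fun_prop
  calc ∫⁻ x, edist ω x ∂μ
      ≤ ∫⁻ x, ENNReal.ofReal r + ENNReal.ofReal (max (dist ω x - r) 0) ∂μ := by
        refine lintegral_mono fun x => ?_
        rw [edist_dist]
        refine (ENNReal.ofReal_le_ofReal ?_).trans ENNReal.ofReal_add_le
        linarith [le_max_left (dist ω x - r) 0]
    _ = ENNReal.ofReal r + ∫⁻ t in Ioi 0, μ {x | t ≤ max (dist ω x - r) 0} := by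
        rw [lintegral_add_left measurable_const, lintegral_const, measure_univ, mul_one,
          lintegral_eq_lintegral_meas_le μ (f := fun x => max (dist ω x - r) 0)
            (Eventually.of_forall fun x => le_max_right _ _) hcont.measurable.aemeasurable]
    _ ≤ _ := by
        gcongr ENNReal.ofReal r + ?_
        refine setLIntegral_mono' measurableSet_Ioi fun t (ht : 0 < t) => ?_
        have hset : {x | t ≤ max (dist ω x - r) 0} = {x | r + t ≤ dist ω x} := by
          ext x
          simp [ht.not_ge, le_sub_iff_add_le, add_comm]
        rw [hset, ← ofReal_measureReal]
        exact ENNReal.ofReal_le_ofReal (measureReal_le_dist_le_concentrationFunction ht hr)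

/-- A ball of measure above `α(δ)` thickens to a ball of measure at least `1 / 2`, and then its
centre has a small mean distance to the other points, hence so do two independent points. -/
theorem measureReal_ball_le_concentrationFunction [SecondCountableTopology Ω] {δ r : ℝ}
    (hδ : 0 < δ)
    (hdist : 2 * (ENNReal.ofReal (r + δ) +
      ∫⁻ t in Ioi 0, ENNReal.ofReal (concentrationFunction μ t)) <
        ∫⁻ p, edist p.1 p.2 ∂(μ.prod μ)) (ω : Ω) :
    μ.real (Metric.ball ω r) ≤ concentrationFunction μ δ := by
  by_contra! hlt
  have hball : 1 / 2 ≤ μ.real (Metric.ball ω (r + δ)) :=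
    (half_le_measureReal_thickening_of_concentrationFunction_lt hδ hlt).trans
      (measureReal_mono ((Metric.thickening_ball ω δ r).trans_eq (by rw [add_comm])))
  refine hdist.not_ge ?_
  calc ∫⁻ p, edist p.1 p.2 ∂(μ.prod μ)
      ≤ ∫⁻ p, edist ω p.1 + edist ω p.2 ∂(μ.prod μ) :=
        lintegral_mono fun p => edist_triangle_left _ _ _
    _ = ∫⁻ x, edist ω x ∂μ + ∫⁻ x, edist ω x ∂μ := by
        rw [lintegral_add_left (by fun_prop),
          measurePreserving_fst.lintegral_comp (f := edist ω) (by fun_prop),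
          measurePreserving_snd.lintegral_comp (f := edist ω) (by fun_prop)]
    _ ≤ _ := by
        rw [two_mul]
        gcongr <;> exact lintegral_edist_le_of_half_le_measureReal_ball hball

end Concentration

/-- The concentration function of `μ` is at most `ε ↦ C * exp (-(a * ε ^ 2))`. In the theorem,
`a = c * d`. -/
def HasGaussianConcentration {Ω : Type*} [MetricSpace Ω] [MeasurableSpace Ω] (μ : Measure Ω)
    (C a : ℝ) : Prop :=
  ∀ ε : ℝ, 0 ≤ ε → concentrationFunction μ ε ≤ C * Real.exp (-(a * ε ^ 2))

namespace HasGaussianConcentration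

variable {Ω : Type*} [MetricSpace Ω] [MeasurableSpace Ω] {μ : Measure Ω} {C a : ℝ}

theorem half_le (h : HasGaussianConcentration μ C a) : 1 / 2 ≤ C := by
  simpa [concentrationFunction] using h 0 le_rfl

theorem lintegral_concentrationFunction_le (h : HasGaussianConcentration μ C a) (ha : 0 < a) :
    ∫⁻ t in Ioi 0, ENNReal.ofReal (concentrationFunction μ t) ≤
      ENNReal.ofReal (C * (√(Real.pi / a) / 2)) := by
  have hC : 0 ≤ C := one_half_pos.le.trans h.half_le
  have hint : IntegrableOn (fun t : ℝ => C * Real.exp (-a * t ^ 2)) (Ioi 0) :=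
    ((integrable_exp_neg_mul_sq ha).const_mul C).integrableOn
  calc ∫⁻ t in Ioi 0, ENNReal.ofReal (concentrationFunction μ t)
      ≤ ∫⁻ t in Ioi 0, ENNReal.ofReal (C * Real.exp (-a * t ^ 2)) :=
        setLIntegral_mono' measurableSet_Ioi fun t ht => ENNReal.ofReal_le_ofReal
          (by simpa only [neg_mul] using h t (le_of_lt ht))
    _ = _ := by
        rw [← ofReal_integral_eq_lintegral_ofReal hint (ae_of_all _ fun t => by positivity),
          integral_const_mul, integral_gaussian_Ioi]

end HasGaussianConcentration

section Cells

open scoped Pointwise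

variable {Ω : Type*}

/-- The functions that describe the cells at depth at most `m` of a tree with decision functions
in `F`: the minimum `φ` of at most `m` functions `f` or `-f` with `f ∈ F` stands for the cell
`{ω | 0 ≤ φ ω}`, the intersection of the corresponding half-spaces. -/
def cellFunctions (F : Set (Ω → ℝ)) : ℕ → Set (Ω → ℝ)
  | 0 => {0}
  | m + 1 => cellFunctions F m ∪ image2 (· ⊓ ·) (F ∪ -F) (cellFunctions F m)

theorem cellFunctions_mono (F : Set (Ω → ℝ)) : Monotone (cellFunctions F) :=
  monotone_nat_of_le_succ fun _ => subset_union_left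

theorem inf_mem_cellFunctions {F : Set (Ω → ℝ)} {g φ : Ω → ℝ} {m : ℕ} (hg : g ∈ F ∪ -F)
    (hφ : φ ∈ cellFunctions F m) : g ⊓ φ ∈ cellFunctions F (m + 1) :=
  Or.inr (mem_image2_of_mem hg hφ)

theorem continuous_of_mem_cellFunctions [TopologicalSpace Ω] {F : Set (Ω → ℝ)}
    (hF : ∀ f ∈ F, Continuous f) {m : ℕ} {φ : Ω → ℝ} (hφ : φ ∈ cellFunctions F m) :
    Continuous φ := by
  induction m generalizing φ with
  | zero => exact hφ ▸ continuous_zero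
  | succ m ih =>
    obtain hφ | ⟨g, hg | hg, ψ, hψ, rfl⟩ := hφ
    · exact ih hφ
    · exact (hF g hg).inf (ih hψ)
    · exact (neg_neg g ▸ (hF _ hg).neg).inf (ih hψ)

theorem thickening_nonneg_inf_subset [PseudoEMetricSpace Ω] {g : Ω → ℝ} (hg : LipschitzWith 1 g)
    (φ : Ω → ℝ) (ε : ℝ) :
    Metric.thickening ε {ω | 0 ≤ (g ⊓ φ) ω} ⊆
      Metric.thickening ε {ω | 0 ≤ φ ω} ∩ {ω | -ε < g ω} := by
  intro ω hω
  obtain ⟨y, hy, hωy⟩ := (Metric.mem_thickening_iff_exists_edist_lt _ _).1 hω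
  obtain ⟨hgy, hφy⟩ : 0 ≤ g y ∧ 0 ≤ φ y := le_inf_iff.1 hy
  have hdist : |g ω - g y| < ε := by
    rw [← Real.dist_eq, ← edist_lt_ofReal]
    exact (by simpa using hg ω y : edist (g ω) (g y) ≤ edist ω y).trans_lt hωy
  exact ⟨(Metric.mem_thickening_iff_exists_edist_lt _ _).2 ⟨y, hφy, hωy⟩,
    by change -ε < g ω; linarith [neg_abs_le (g ω - g y)]⟩

end Cells

namespace IndexTree

variable {Ω : Type*} {X : Set Ω} {ε : ℝ}

theorem rangeCost_mono (X : Set Ω) (ω : Ω) (T : IndexTree Ω) :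
    Monotone fun ε => T.rangeCost X ω ε := by
  intro ε ε' h
  induction T with
  | leaf B => simp [rangeCost]
  | node B f tneg tpos ihneg ihpos =>
    simp only [rangeCost] at *
    gcongr <;> split_ifs <;> first | assumption | positivity | linarith

theorem ncard_inter_block_node_le {f φ : Ω → ℝ} {B : Set Ω} {tneg tpos : IndexTree Ω}
    (hX : X.Finite) (hcov : B ⊆ tneg.block ∪ tpos.block) (hneg : ∀ ω ∈ tneg.block, f ω ≤ 0)
    (hpos : ∀ ω ∈ tpos.block, 0 ≤ f ω) :
    (X ∩ {ω | 0 ≤ φ ω} ∩ B).ncard ≤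
      (X ∩ {ω | 0 ≤ (-f ⊓ φ) ω} ∩ tneg.block).ncard +
        (X ∩ {ω | 0 ≤ (f ⊓ φ) ω} ∩ tpos.block).ncard := by
  refine (ncard_le_ncard ?_ (((hX.inter_of_left _).inter_of_left _).union
    ((hX.inter_of_left _).inter_of_left _))).trans (ncard_union_le _ _)
  rintro x ⟨⟨hxX, hxφ⟩, hxB⟩
  rcases hcov hxB with hx | hx
  · exact Or.inl ⟨⟨hxX, le_inf (neg_nonneg.2 (hneg x hx)) hxφ⟩, hx⟩
  · exact Or.inr ⟨⟨hxX, le_inf (hpos x hx) hxφ⟩, hx⟩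

theorem ncard_inter_inter_le_or_one_le_two_mul {S : Set Ω} {p : ℕ} {a : ℝ≥0∞} (hX : X.Finite)
    (ha : p < (X ∩ S).ncard → 2⁻¹ ≤ a) (B : Set Ω) : (X ∩ S ∩ B).ncard ≤ p ∨ 1 ≤ 2 * a := by
  rcases le_or_gt (X ∩ S).ncard p with hle | hlt
  · exact Or.inl ((ncard_le_ncard inter_subset_left (hX.inter_of_left _)).trans hle)
  · refine Or.inr ((ENNReal.mul_inv_cancel two_ne_zero ENNReal.ofNat_ne_top).symm.le.trans ?_)
    gcongr
    exact ha hlt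

/-- The contribution of the query points within `ε` of the cell `{ω | 0 ≤ φ ω}` to the mean cost
of the range queries of radius `ε` in the tree `T`. -/
noncomputable def cellCost [PseudoEMetricSpace Ω] [MeasurableSpace Ω] (ν : Measure Ω)
    (X : Set Ω) (ε : ℝ) (φ : Ω → ℝ) (T : IndexTree Ω) : ℝ≥0∞ :=
  ∫⁻ ω in Metric.thickening ε {ω | 0 ≤ φ ω}, (T.rangeCost X ω ε : ℝ≥0∞) ∂ν

theorem cellCost_leaf [PseudoEMetricSpace Ω] [MeasurableSpace Ω] (ν : Measure Ω) (X : Set Ω) (ε : ℝ)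
    (φ : Ω → ℝ) (B : Set Ω) :
    cellCost ν X ε φ (leaf B) =
      (1 + (X ∩ B).ncard : ℕ) * ν (Metric.thickening ε {ω | 0 ≤ φ ω}) := by
  simp only [cellCost, rangeCost, lintegral_const, Measure.restrict_apply_univ]

theorem ncard_inter_le_two_mul_cellCost_leaf [PseudoEMetricSpace Ω] [MeasurableSpace Ω]
    {ν : Measure Ω} {φ : Ω → ℝ} (hX : X.Finite)
    (hν : 1 ≤ 2 * ν (Metric.thickening ε {ω | 0 ≤ φ ω})) (B : Set Ω) :
    ((X ∩ {ω | 0 ≤ φ ω} ∩ B).ncard : ℝ≥0∞) ≤ 2 * cellCost ν X ε φ (leaf B) := by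
  have hsub : (X ∩ {ω | 0 ≤ φ ω} ∩ B).ncard ≤ 1 + (X ∩ B).ncard :=
    (ncard_le_ncard (inter_subset_inter_left _ inter_subset_left)
      (hX.inter_of_left _)).trans (Nat.le_add_left _ _)
  calc ((X ∩ {ω | 0 ≤ φ ω} ∩ B).ncard : ℝ≥0∞) ≤ (1 + (X ∩ B).ncard : ℕ) * 1 := by
        rw [mul_one]
        exact Nat.cast_le.2 hsub
    _ ≤ (1 + (X ∩ B).ncard : ℕ) * (2 * ν (Metric.thickening ε {ω | 0 ≤ φ ω})) := by gcongr
    _ = 2 * cellCost ν X ε φ (leaf B) := by rw [cellCost_leaf, mul_left_comm]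

theorem measure_add_cellCost_le_cellCost_node [PseudoEMetricSpace Ω] [MeasurableSpace Ω]
    [OpensMeasurableSpace Ω] (ν : Measure Ω) (X : Set Ω) (ε : ℝ) (φ : Ω → ℝ) (B : Set Ω)
    {f : Ω → ℝ} (hf : LipschitzWith 1 f) (tneg tpos : IndexTree Ω) :
    ν (Metric.thickening ε {ω | 0 ≤ φ ω}) + cellCost ν X ε (-f ⊓ φ) tneg +
        cellCost ν X ε (f ⊓ φ) tpos ≤ cellCost ν X ε φ (node B f tneg tpos) := by
  have hneg := thickening_nonneg_inf_subset hf.neg φ ε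
  have hpos := thickening_nonneg_inf_subset hf φ ε
  unfold cellCost
  set W := Metric.thickening ε {ω | 0 ≤ φ ω}
  set Wneg := Metric.thickening ε {ω | 0 ≤ (-f ⊓ φ) ω} with hWneg
  set Wpos := Metric.thickening ε {ω | 0 ≤ (f ⊓ φ) ω} with hWpos
  calc _ = (∫⁻ _ in W, 1 ∂ν)
          + (∫⁻ ω in W, Wneg.indicator (fun ω => (tneg.rangeCost X ω ε : ℝ≥0∞)) ω ∂ν)
          + ∫⁻ ω in W, Wpos.indicator (fun ω => (tpos.rangeCost X ω ε : ℝ≥0∞)) ω ∂ν := by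
        rw [setLIntegral_indicator (hWneg ▸ Metric.isOpen_thickening.measurableSet),
          setLIntegral_indicator (hWpos ▸ Metric.isOpen_thickening.measurableSet),
          setLIntegral_one, inter_eq_left.2 (hneg.trans inter_subset_left),
          inter_eq_left.2 (hpos.trans inter_subset_left)]
    _ ≤ ∫⁻ ω in W, 1 + Wneg.indicator (fun ω => (tneg.rangeCost X ω ε : ℝ≥0∞)) ω
          + Wpos.indicator (fun ω => (tpos.rangeCost X ω ε : ℝ≥0∞)) ω ∂ν :=
        (add_le_add_left (le_lintegral_add _ _) _).trans (le_lintegral_add _ _)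
    _ ≤ _ := by
        refine lintegral_mono fun ω => ?_
        simp only [rangeCost, Nat.cast_add, Nat.cast_one]
        gcongr
        · refine indicator_apply_le' (fun hω => ?_) fun _ => zero_le
          rw [if_pos (neg_lt_neg_iff.1 (hneg hω).2)]
        · refine indicator_apply_le' (fun hω => ?_) fun _ => zero_le
          rw [if_pos (mem_ofPred.1 (hpos hω).2)]

variable [MetricSpace Ω] [MeasurableSpace Ω] [OpensMeasurableSpace Ω]
  {ν : Measure Ω} {F : Set (Ω → ℝ)} {p M : ℕ}

/-- A node whose cell holds more than `p` datapoints is accessed with probability at least `1 / 2`.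
Hence at most `2 * J` nodes of the subtree, where `J` is the mean cost, have such a cell; the
datapoints in the bins of the others are accounted for by at most `2 * J + 1` cells with at most
`p` datapoints each. -/
theorem ncard_inter_block_le (hX : X.Finite)
    (hcell : ∀ φ ∈ cellFunctions F M, p < (X ∩ {ω | 0 ≤ φ ω}).ncard →
      2⁻¹ ≤ ν (Metric.thickening ε {ω | 0 ≤ φ ω}))
    {T : IndexTree Ω} (hT : T.Admissible F) {m : ℕ} {φ : Ω → ℝ} (hφ : φ ∈ cellFunctions F m)
    (hM : m + 2 * cellCost ν X ε φ T ≤ M) :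
    ((X ∩ {ω | 0 ≤ φ ω} ∩ T.block).ncard : ℝ≥0∞) ≤ p + (p + 1) * (2 * cellCost ν X ε φ T) := by
  have hφM {a : ℝ≥0∞} {m : ℕ} {φ : Ω → ℝ} (hφ : φ ∈ cellFunctions F m) (hM : m + a ≤ M) :
      φ ∈ cellFunctions F M := cellFunctions_mono F (Nat.cast_le.1 (le_self_add.trans hM)) hφ
  induction T generalizing m φ with
  | leaf B =>
    rcases ncard_inter_inter_le_or_one_le_two_mul hX (hcell φ (hφM hφ hM)) B with hthin | hfat
    · exact le_add_right (Nat.cast_le.2 hthin)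
    calc ((X ∩ {ω | 0 ≤ φ ω} ∩ B).ncard : ℝ≥0∞)
        ≤ 0 + (0 + 1) * (2 * cellCost ν X ε φ (leaf B)) := by
          simpa using ncard_inter_le_two_mul_cellCost_leaf hX hfat B
      _ ≤ _ := by gcongr <;> exact zero_le
  | node B f tneg tpos ihneg ihpos =>
    obtain ⟨hfF, hfL, hcov, hneg, hpos, hTneg, hTpos⟩ := hT
    rcases ncard_inter_inter_le_or_one_le_two_mul hX (hcell φ (hφM hφ hM)) B with hthin | hfat
    · exact le_add_right (Nat.cast_le.2 hthin)
    have hcost : 1 + 2 * cellCost ν X ε (-f ⊓ φ) tneg + 2 * cellCost ν X ε (f ⊓ φ) tpos ≤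
        2 * cellCost ν X ε φ (node B f tneg tpos) := by
      refine (add_le_add_left (add_le_add_left hfat _) _).trans ?_
      rw [← mul_add, ← mul_add]
      gcongr
      exact measure_add_cellCost_le_cellCost_node ν X ε φ B hfL tneg tpos
    have hMle {a : ℝ≥0∞} (ha : 1 + a ≤ 2 * cellCost ν X ε φ (node B f tneg tpos)) :
        ((m + 1 : ℕ) : ℝ≥0∞) + a ≤ M := by
      rw [Nat.cast_add, Nat.cast_one, add_assoc]
      exact (add_le_add_right ha _).trans hM
    have hnegM := hMle (le_self_add.trans hcost)
    have hposM := hMle ((add_le_add_left le_self_add _).trans hcost)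
    calc ((X ∩ {ω | 0 ≤ φ ω} ∩ B).ncard : ℝ≥0∞)
        ≤ (X ∩ {ω | 0 ≤ (-f ⊓ φ) ω} ∩ tneg.block).ncard +
            (X ∩ {ω | 0 ≤ (f ⊓ φ) ω} ∩ tpos.block).ncard := by
          exact_mod_cast ncard_inter_block_node_le hX hcov hneg hpos
      _ ≤ (p + (p + 1) * (2 * cellCost ν X ε (-f ⊓ φ) tneg)) +
            (p + (p + 1) * (2 * cellCost ν X ε (f ⊓ φ) tpos)) + 1 :=
          (add_le_add
            (ihneg hTneg (inf_mem_cellFunctions (Or.inr (by simpa using hfF)) hφ) hnegM)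
            (ihpos hTpos (inf_mem_cellFunctions (Or.inl hfF) hφ) hposM)).trans le_self_add
      _ = p + (p + 1) * (1 + 2 * cellCost ν X ε (-f ⊓ φ) tneg +
            2 * cellCost ν X ε (f ⊓ φ) tpos) := by ring
      _ ≤ p + (p + 1) * (2 * cellCost ν X ε φ (node B f tneg tpos)) := by gcongr

theorem cellCost_zero_restrict_compl_thickening_le_avgNNCost (μ : Measure Ω) (hX : X.Nonempty)
    (ε : ℝ) (T : IndexTree Ω) :
    cellCost (μ.restrict (Metric.thickening ε X)ᶜ) X ε 0 T ≤ T.avgNNCost μ X := by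
  calc cellCost (μ.restrict (Metric.thickening ε X)ᶜ) X ε 0 T
      ≤ ∫⁻ ω in (Metric.thickening ε X)ᶜ, (T.rangeCost X ω ε : ℝ≥0∞) ∂μ :=
        setLIntegral_le_lintegral _ _
    _ ≤ ∫⁻ ω in (Metric.thickening ε X)ᶜ, (T.nnCost X ω : ℝ≥0∞) ∂μ := by
        refine setLIntegral_mono' Metric.isOpen_thickening.measurableSet.compl fun ω hω => ?_
        refine Nat.cast_le.2 (rangeCost_mono X ω T (not_lt.1 fun hlt => hω ?_))
        exact (Metric.mem_thickening_iff_infDist_lt hX).2 hlt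
    _ ≤ T.avgNNCost μ X := setLIntegral_le_lintegral _ _

theorem natCast_le_avgNNCost {μ : Measure Ω} {Q : ℕ} (hX : X.Finite)
    (hcell : ∀ φ ∈ cellFunctions F (2 * Q), p < (X ∩ {ω | 0 ≤ φ ω}).ncard →
      2⁻¹ ≤ μ (Metric.thickening ε {ω | 0 ≤ φ ω} \ Metric.thickening ε X))
    (hcard : p + (p + 1) * (2 * Q) < X.ncard) {T : IndexTree Ω} (hT : T.IsMetricTree F) :
    (Q : ℝ≥0∞) ≤ T.avgNNCost μ X := by
  by_contra! hlt
  have hne : X.Nonempty := nonempty_of_ncard_ne_zero (by omega)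
  have hcost := (cellCost_zero_restrict_compl_thickening_le_avgNNCost μ hne ε T).trans hlt.le
  have hle := ncard_inter_block_le (ν := μ.restrict (Metric.thickening ε X)ᶜ) (p := p) hX
    (fun φ hφ hp => (hcell φ hφ hp).trans_eq
      (Measure.restrict_apply Metric.isOpen_thickening.measurableSet).symm)
    hT.2 (m := 0) rfl (by
      rw [Nat.cast_zero, zero_add, Nat.cast_mul, Nat.cast_ofNat]
      gcongr)
  simp only [hT.1, Pi.zero_apply, le_refl, ofPred_true, inter_univ] at hle
  have hle' : (X.ncard : ℝ≥0∞) ≤ (p + (p + 1) * (2 * Q) : ℕ) := by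
    push_cast
    exact hle.trans (by gcongr)
  exact hcard.not_ge (Nat.cast_le.1 hle')

end IndexTree

section Traces

open scoped Pointwise

theorem sum_Iic_choose_le_pow (N D : ℕ) : ∑ i ∈ Finset.Iic D, N.choose i ≤ (N + 1) ^ D := by
  rw [← Nat.range_succ_eq_Iic]
  induction D with
  | zero => simp
  | succ D ih =>
    calc ∑ i ∈ Finset.range (D + 1 + 1), N.choose i
        ≤ (N + 1) ^ D + N ^ (D + 1) := by
          rw [Finset.sum_range_succ]
          exact add_le_add ih (N.choose_le_pow _)
      _ ≤ (N + 1) ^ D + N * (N + 1) ^ D := by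
          rw [pow_succ']
          gcongr
          omega
      _ = (N + 1) ^ (D + 1) := by ring

theorem exists_forall_le_iff_lt {I : Type*} [Finite I] (v : I → ℝ) (c : ℝ) :
    ∃ a, ∀ i, a ≤ v i ↔ c < v i := by
  have h : ∀ᶠ a in 𝓝[>] c, ∀ i, a ≤ v i ↔ c < v i := by
    refine Filter.eventually_all.2 fun i => ?_
    rcases lt_or_ge c (v i) with hi | hi
    · filter_upwards [Ioo_mem_nhdsGT hi] with a ha
      exact ⟨fun _ => hi, fun _ => ha.2.le⟩
    · filter_upwards [self_mem_nhdsWithin] with a ha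
      exact ⟨fun h => ha.trans_le h, fun h => absurd hi h.not_ge⟩
  exact h.exists

variable {Ω I : Type*} [Fintype I] {𝒜 ℬ : Set (Set Ω)} {D : ℕ}

open Classical in
/-- The traces of the members of `𝒜` on the finite family of points `z`, recorded as sets of
indices. -/
noncomputable def traces (𝒜 : Set (Set Ω)) (z : I → Ω) : Finset (Finset I) :=
  {t | ∃ A ∈ 𝒜, ∀ i, i ∈ t ↔ z i ∈ A}

theorem mem_traces {z : I → Ω} {t : Finset I} :
    t ∈ traces 𝒜 z ↔ ∃ A ∈ 𝒜, ∀ i, i ∈ t ↔ z i ∈ A := by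
  simp [traces]

theorem card_traces_mono (h : 𝒜 ⊆ ℬ) (z : I → Ω) : (traces 𝒜 z).card ≤ (traces ℬ z).card := by
  refine Finset.card_le_card fun t ht => ?_
  obtain ⟨A, hA, htA⟩ := mem_traces.1 ht
  exact mem_traces.2 ⟨A, h hA, htA⟩

theorem card_traces_union_le (𝒜 ℬ : Set (Set Ω)) (z : I → Ω) :
    (traces (𝒜 ∪ ℬ) z).card ≤ (traces 𝒜 z).card + (traces ℬ z).card := by
  classical
  refine (Finset.card_le_card fun t ht => ?_).trans (Finset.card_union_le _ _)
  obtain ⟨A, hA | hA, htA⟩ := mem_traces.1 ht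
  · exact Finset.mem_union_left _ (mem_traces.2 ⟨A, hA, htA⟩)
  · exact Finset.mem_union_right _ (mem_traces.2 ⟨A, hA, htA⟩)

theorem card_traces_image_compl_le (𝒜 : Set (Set Ω)) (z : I → Ω) :
    (traces (compl '' 𝒜) z).card ≤ (traces 𝒜 z).card := by
  classical
  refine (Finset.card_le_card fun t ht => ?_).trans (Finset.card_image_le (f := compl))
  obtain ⟨_, ⟨A, hA, rfl⟩, htA⟩ := mem_traces.1 ht
  refine Finset.mem_image.2 ⟨tᶜ, mem_traces.2 ⟨A, hA, fun i => ?_⟩, compl_compl t⟩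
  rw [Finset.mem_compl, htA, notMem_compl_iff]

theorem card_traces_image2_inter_le (𝒜 ℬ : Set (Set Ω)) (z : I → Ω) :
    (traces (image2 (· ∩ ·) 𝒜 ℬ) z).card ≤ (traces 𝒜 z).card * (traces ℬ z).card := by
  classical
  refine (Finset.card_le_card fun t ht => ?_).trans (Finset.card_image₂_le (· ∩ ·) _ _)
  obtain ⟨_, ⟨A, hA, B, hB, rfl⟩, ht⟩ := mem_traces.1 ht
  refine Finset.mem_image₂.2 ⟨({i | z i ∈ A} : Finset I), mem_traces.2 ⟨A, hA, by simp⟩,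
    ({i | z i ∈ B} : Finset I), mem_traces.2 ⟨B, hB, by simp⟩, ?_⟩
  ext i
  simp [ht]

theorem shatters_image_of_shatters_traces [DecidableEq I] {z : I → Ω} {s : Finset I}
    (hs : (traces 𝒜 z).Shatters s) : Shatters 𝒜 (z '' s) := by
  classical
  intro C hC
  obtain ⟨u, hu, hsu⟩ := hs (Finset.filter_subset (fun i => z i ∈ C) s)
  obtain ⟨A, hA, huA⟩ := mem_traces.1 hu
  have hiff {i : I} (hi : i ∈ s) : z i ∈ A ↔ z i ∈ C := by
    rw [← huA]
    simpa [hi] using Finset.ext_iff.1 hsu i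
  refine ⟨A, hA, Subset.antisymm ?_ fun ω hω => ?_⟩
  · rintro _ ⟨hωA, i, hi, rfl⟩
    exact (hiff hi).1 hωA
  · obtain ⟨i, hi, rfl⟩ := hC hω
    exact ⟨(hiff hi).2 hω, i, hi, rfl⟩

theorem injOn_of_shatters_traces [DecidableEq I] {z : I → Ω} {s : Finset I}
    (hs : (traces 𝒜 z).Shatters s) : InjOn z s := by
  intro i hi j hj hij
  obtain ⟨u, hu, hsu⟩ := hs (Finset.singleton_subset_iff.2 hi)
  obtain ⟨A, -, huA⟩ := mem_traces.1 hu
  have hiu : i ∈ u := (Finset.mem_inter.1 (hsu ▸ Finset.mem_singleton_self i)).2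
  have hju : j ∈ u := (huA j).2 (hij ▸ (huA i).1 hiu)
  exact (Finset.mem_singleton.1 (hsu ▸ Finset.mem_inter.2 ⟨hj, hju⟩)).symm

theorem vcDim_traces_le [DecidableEq I] (hD : vcDim 𝒜 ≤ D) (z : I → Ω) :
    (traces 𝒜 z).vcDim ≤ D := by
  refine Finset.sup_le fun s hs => ?_
  have hs := Finset.mem_shatterer.1 hs
  have hle : (z '' s).encard ≤ D :=
    (le_iSup₂ (f := fun (B : Set Ω) (_ : Shatters 𝒜 B) => B.encard) _
      (shatters_image_of_shatters_traces hs)).trans hD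
  rw [(injOn_of_shatters_traces hs).encard_image, encard_coe_eq_coe_finsetCard] at hle
  exact Nat.cast_le.1 hle

theorem card_traces_le_of_vcDim_le (hD : vcDim 𝒜 ≤ D) (z : I → Ω) :
    (traces 𝒜 z).card ≤ (Fintype.card I + 1) ^ D := by
  classical
  calc (traces 𝒜 z).card ≤ (traces 𝒜 z).shatterer.card := Finset.card_le_card_shatterer _
    _ ≤ ∑ k ∈ Finset.Iic (traces 𝒜 z).vcDim, (Fintype.card I).choose k :=
      Finset.card_shatterer_le_sum_vcDim
    _ ≤ ∑ k ∈ Finset.Iic D, (Fintype.card I).choose k :=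
      Finset.sum_le_sum_of_subset (Finset.Iic_subset_Iic.2 (vcDim_traces_le hD z))
    _ ≤ _ := sum_Iic_choose_le_pow _ _

/-- The sets `{ω | c < φ ω}`, `φ ∈ Φ`, `c ∈ ℝ`. Unlike the superlevel sets in the statement they
are open when the functions are continuous, which makes the events of the symmetrization argument
measurable for an arbitrary class `Φ`. -/
def strictSuperlevelSets (Φ : Set (Ω → ℝ)) : Set (Set Ω) :=
  {S | ∃ φ ∈ Φ, ∃ c : ℝ, S = {ω | c < φ ω}}

theorem card_traces_strictSuperlevelSets_le (F : Set (Ω → ℝ)) (z : I → Ω) :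
    (traces (strictSuperlevelSets F) z).card ≤ (traces (superlevelSets F) z).card := by
  refine Finset.card_le_card fun t ht => ?_
  obtain ⟨_, ⟨f, hf, c, rfl⟩, htc⟩ := mem_traces.1 ht
  obtain ⟨a, ha⟩ := exists_forall_le_iff_lt (fun i => f (z i)) c
  exact mem_traces.2 ⟨_, ⟨f, hf, a, rfl⟩, fun i => (htc i).trans (ha i).symm⟩

theorem strictSuperlevelSets_union_neg_subset (F : Set (Ω → ℝ)) :
    strictSuperlevelSets (F ∪ -F) ⊆ strictSuperlevelSets F ∪ compl '' superlevelSets F := by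
  rintro _ ⟨f, hf | hf, c, rfl⟩
  · exact Or.inl ⟨f, hf, c, rfl⟩
  · refine Or.inr ⟨_, ⟨-f, hf, -c, rfl⟩, ?_⟩
    ext ω
    simp

theorem strictSuperlevelSets_cellFunctions_succ_subset (F : Set (Ω → ℝ)) (m : ℕ) :
    strictSuperlevelSets (cellFunctions F (m + 1)) ⊆
      strictSuperlevelSets (cellFunctions F m) ∪
        image2 (· ∩ ·) (strictSuperlevelSets (F ∪ -F))
          (strictSuperlevelSets (cellFunctions F m)) := by
  rintro _ ⟨_, hφ | ⟨g, hg, φ, hφ, rfl⟩, c, rfl⟩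
  · exact Or.inl ⟨_, hφ, c, rfl⟩
  · refine Or.inr ⟨_, ⟨g, hg, c, rfl⟩, _, ⟨φ, hφ, c, rfl⟩, ?_⟩
    ext ω
    simp

theorem card_traces_strictSuperlevelSets_cellFunctions_zero_le (F : Set (Ω → ℝ)) (z : I → Ω) :
    (traces (strictSuperlevelSets (cellFunctions F 0)) z).card ≤ 2 := by
  classical
  refine (Finset.card_le_card (t := {Finset.univ, ∅}) fun t ht => ?_).trans Finset.card_le_two
  obtain ⟨_, ⟨_, rfl, c, rfl⟩, htc⟩ := mem_traces.1 ht
  rw [Finset.mem_insert, Finset.mem_singleton]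
  by_cases hc : c < 0
  · exact Or.inl (Finset.eq_univ_of_forall fun i => (htc i).2 hc)
  · exact Or.inr (Finset.eq_empty_of_forall_notMem fun i hi => hc ((htc i).1 hi))

theorem card_traces_strictSuperlevelSets_cellFunctions_le {F : Set (Ω → ℝ)}
    (hD : vcDim (superlevelSets F) ≤ D) (z : I → Ω) (m : ℕ) :
    (traces (strictSuperlevelSets (cellFunctions F m)) z).card ≤
      2 * (2 * (Fintype.card I + 1) ^ D + 1) ^ m := by
  have hF : (traces (strictSuperlevelSets (F ∪ -F)) z).card ≤
      2 * (Fintype.card I + 1) ^ D := by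
    refine (card_traces_mono (strictSuperlevelSets_union_neg_subset F) z).trans
      ((card_traces_union_le _ _ z).trans ?_)
    have hstrict := card_traces_strictSuperlevelSets_le F z
    have hcompl := card_traces_image_compl_le (superlevelSets F) z
    have hsauer := card_traces_le_of_vcDim_le hD z
    omega
  induction m with
  | zero => simpa using card_traces_strictSuperlevelSets_cellFunctions_zero_le F z
  | succ m ih =>
    set 𝒯 := traces (strictSuperlevelSets (cellFunctions F m)) z
    calc (traces (strictSuperlevelSets (cellFunctions F (m + 1))) z).card
        ≤ 𝒯.card + (traces (strictSuperlevelSets (F ∪ -F)) z).card * 𝒯.card :=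
          (card_traces_mono (strictSuperlevelSets_cellFunctions_succ_subset F m) z).trans
            ((card_traces_union_le _ _ z).trans
              (Nat.add_le_add_left (card_traces_image2_inter_le _ _ z) _))
      _ = ((traces (strictSuperlevelSets (F ∪ -F)) z).card + 1) * 𝒯.card := by ring
      _ ≤ (2 * (Fintype.card I + 1) ^ D + 1) * (2 * (2 * (Fintype.card I + 1) ^ D + 1) ^ m) := by
          gcongr
      _ = _ := by ring

end Traces

section Symmetrization

variable {Ω ι : Type*}

theorem exists_lt_zero_forall_lt [Finite ι] {v : ι → ℝ} (hv : ∀ i, v i < 0) :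
    ∃ c < 0, ∀ i, v i < c := by
  have hev : ∀ᶠ c in 𝓝[<] (0 : ℝ), ∀ i, v i < c :=
    Filter.eventually_all.2 fun i => (eventually_gt_nhds (hv i)).filter_mono nhdsWithin_le_nhds
  exact ((eventually_mem_nhdsWithin (a := (0 : ℝ)) (s := Iio 0)).and hev).exists

/-- The pairs of samples such that, for some `φ ∈ Φ` and `c`, at least `p` points of the first
sample lie in `{ω | c < φ ω}` and all points of the second sample lie in `{ω | φ ω < c}`. -/
def discrepantPairs (Φ : Set (Ω → ℝ)) (p : ℕ) : Set (ι → Ω × Ω) :=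
  {w | ∃ φ ∈ Φ, ∃ c : ℝ, (∃ s : Finset ι, p ≤ s.card ∧ ∀ i ∈ s, c < φ (w i).1) ∧
    ∀ i, φ (w i).2 < c}

/-- Exchange of the two points in the pairs selected by `σ`. -/
def swapPairs (σ : ι → Bool) (w : ι → Ω × Ω) : ι → Ω × Ω :=
  fun i => (if σ i then Prod.swap else id) (w i)

theorem isOpen_discrepantPairs [Finite ι] [TopologicalSpace Ω] {Φ : Set (Ω → ℝ)}
    (hΦ : ∀ φ ∈ Φ, Continuous φ) (p : ℕ) : IsOpen (discrepantPairs (ι := ι) Φ p) := by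
  refine isOpen_iff_eventually.2 ?_
  rintro w ⟨φ, hφ, c, ⟨s, hs, hfst⟩, hsnd⟩
  have hφ₁ (i : ι) : Continuous fun w : ι → Ω × Ω => φ (w i).1 := (hΦ φ hφ).comp (by fun_prop)
  have hφ₂ (i : ι) : Continuous fun w : ι → Ω × Ω => φ (w i).2 := (hΦ φ hφ).comp (by fun_prop)
  filter_upwards [(Filter.eventually_all_finset s).2 fun i hi =>
      (hφ₁ i).continuousAt.eventually_const_lt (hfst i hi),
    Filter.eventually_all.2 fun i => (hφ₂ i).continuousAt.eventually_lt_const (hsnd i)]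
    with w' hfst' hsnd'
  exact ⟨φ, hφ, c, ⟨s, hs, hfst'⟩, hsnd'⟩

variable [Fintype ι]

theorem measurePreserving_swapPairs [MeasurableSpace Ω] (μ : Measure Ω) [SigmaFinite μ]
    (σ : ι → Bool) : MeasurePreserving (swapPairs (Ω := Ω) σ)
      (Measure.pi fun _ => μ.prod μ) (Measure.pi fun _ => μ.prod μ) := by
  refine measurePreserving_pi (fun _ => μ.prod μ) (fun _ => μ.prod μ)
    (f := fun i => if σ i then Prod.swap else id) fun i => ?_
  split_ifs
  · exact Measure.measurePreserving_swap
  · exact MeasurePreserving.id _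

theorem card_filter_eqOn_mul_pow {β : Type*} [Fintype β] [DecidableEq ι] [DecidableEq β]
    (s : Finset ι) (σ₀ : ι → β) :
    ({σ : ι → β | ∀ i ∈ s, σ i = σ₀ i} : Finset (ι → β)).card * Fintype.card β ^ s.card =
      Fintype.card β ^ Fintype.card ι := by
  have hpi : ({σ : ι → β | ∀ i ∈ s, σ i = σ₀ i} : Finset (ι → β)) =
      Fintype.piFinset fun i => if i ∈ s then {σ₀ i} else Finset.univ := by
    ext σ
    simp only [Finset.mem_filter, Finset.mem_univ, true_and, Fintype.mem_piFinset]
    refine forall_congr' fun i => ?_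
    by_cases hi : i ∈ s <;> simp [hi]
  have hcard (i : ι) : (if i ∈ s then ({σ₀ i} : Finset β) else Finset.univ).card =
      if i ∈ s then 1 else Fintype.card β := by
    split_ifs <;> simp
  rw [hpi, Fintype.card_piFinset, Finset.prod_congr rfl fun i _ => hcard i, Finset.prod_ite,
    Finset.prod_const_one, one_mul, Finset.prod_const, Finset.filter_notMem_eq_sdiff,
    ← Finset.compl_eq_univ_sdiff, ← pow_add, add_comm, Finset.card_add_card_compl]

open Classical in
/-- The `p` points chosen by one such `σ₀` force the value of every other `σ` in `p` places. -/
theorem card_choices_mul_two_pow_le (t : Finset (ι × Bool)) (p : ℕ) :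
    ({σ : ι → Bool | (∃ s : Finset ι, p ≤ s.card ∧ ∀ i ∈ s, (i, σ i) ∈ t) ∧
      ∀ i, (i, !σ i) ∉ t} : Finset (ι → Bool)).card * 2 ^ p ≤ 2 ^ Fintype.card ι := by
  set S : Finset (ι → Bool) := {σ | (∃ s : Finset ι, p ≤ s.card ∧ ∀ i ∈ s, (i, σ i) ∈ t) ∧
    ∀ i, (i, !σ i) ∉ t}
  rcases S.eq_empty_or_nonempty with hS | ⟨σ₀, hσ₀⟩
  · simp [hS]
  obtain ⟨⟨s, hps, hs⟩, -⟩ := (Finset.mem_filter.1 hσ₀).2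
  have hsub : S ⊆ ({σ : ι → Bool | ∀ i ∈ s, σ i = σ₀ i} : Finset (ι → Bool)) := by
    refine fun σ hσ => Finset.mem_filter.2 ⟨Finset.mem_univ σ, fun i hi => ?_⟩
    have hi' := (Finset.mem_filter.1 hσ).2.2 i
    contrapose! hi'
    rw [Bool.not_eq_eq_eq_not.2 (Bool.eq_not_of_ne hi')]
    exact hs i hi
  calc S.card * 2 ^ p
      ≤ ({σ : ι → Bool | ∀ i ∈ s, σ i = σ₀ i} : Finset (ι → Bool)).card * 2 ^ s.card := by
        gcongr
        exact one_le_two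
    _ = 2 ^ Fintype.card ι := by simpa using card_filter_eqOn_mul_pow s σ₀

open Classical in
theorem card_swapPairs_mem_mul_two_pow_le {Φ : Set (Ω → ℝ)} {K : ℕ}
    (hK : ∀ z : ι × Bool → Ω, (traces (strictSuperlevelSets Φ) z).card ≤ K) (p : ℕ)
    (w : ι → Ω × Ω) :
    ({σ : ι → Bool | swapPairs σ w ∈ discrepantPairs Φ p} : Finset (ι → Bool)).card * 2 ^ p ≤
      K * 2 ^ Fintype.card ι := by
  set z : ι × Bool → Ω := fun j => if j.2 then (w j.1).2 else (w j.1).1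
  have hfst (σ : ι → Bool) (i : ι) : (swapPairs σ w i).1 = z (i, σ i) := by
    simp only [swapPairs, z]
    cases σ i <;> simp
  have hsnd (σ : ι → Bool) (i : ι) : (swapPairs σ w i).2 = z (i, !σ i) := by
    simp only [swapPairs, z]
    cases σ i <;> simp
  set choices : Finset (ι × Bool) → Finset (ι → Bool) := fun t =>
    {σ | (∃ s : Finset ι, p ≤ s.card ∧ ∀ i ∈ s, (i, σ i) ∈ t) ∧ ∀ i, (i, !σ i) ∉ t}
  have hsub : ({σ : ι → Bool | swapPairs σ w ∈ discrepantPairs Φ p} : Finset (ι → Bool)) ⊆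
      (traces (strictSuperlevelSets Φ) z).biUnion choices := by
    intro σ hσ
    obtain ⟨φ, hφ, c, ⟨s, hps, hs⟩, hlt⟩ := (Finset.mem_filter.1 hσ).2
    simp only [hfst, hsnd] at hs hlt
    refine Finset.mem_biUnion.2 ⟨({j | c < φ (z j)} : Finset (ι × Bool)),
      mem_traces.2 ⟨_, ⟨φ, hφ, c, rfl⟩, by simp⟩, ?_⟩
    exact Finset.mem_filter.2 ⟨Finset.mem_univ σ, ⟨s, hps, by simpa using hs⟩,
      fun i => by simpa using (hlt i).le⟩
  calc _ ≤ (∑ t ∈ traces (strictSuperlevelSets Φ) z, (choices t).card) * 2 ^ p := by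
        gcongr
        exact (Finset.card_le_card hsub).trans Finset.card_biUnion_le
    _ ≤ ∑ _t ∈ traces (strictSuperlevelSets Φ) z, 2 ^ Fintype.card ι := by
        rw [Finset.sum_mul]
        exact Finset.sum_le_sum fun t _ => card_choices_mul_two_pow_le t p
    _ ≤ K * 2 ^ Fintype.card ι := by
        rw [Finset.sum_const, smul_eq_mul]
        gcongr
        exact hK z

open Classical in
theorem sum_measureReal_le_of_card_le {α κ : Type*} [Fintype κ] [MeasurableSpace α]
    {P : Measure α} [IsProbabilityMeasure P] {A : κ → Set α} (hA : ∀ k, MeasurableSet (A k))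
    {N : ℝ} (hN : ∀ x, (({k | x ∈ A k} : Finset κ).card : ℝ) ≤ N) : ∑ k, P.real (A k) ≤ N := by
  have hint (k : κ) : Integrable ((A k).indicator (1 : α → ℝ)) P :=
    (integrable_const 1).indicator (hA k)
  calc ∑ k, P.real (A k) = ∫ x, ∑ k, (A k).indicator (1 : α → ℝ) x ∂P := by
        rw [integral_finsetSum _ fun k _ => hint k]
        exact Finset.sum_congr rfl fun k _ => (integral_indicator_one (hA k)).symm
    _ ≤ ∫ _, N ∂P := by
        refine integral_mono (integrable_finsetSum _ fun k _ => hint k) (integrable_const N)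
          fun x => ?_
        simpa only [indicator_apply, Pi.one_apply, Finset.sum_boole] using hN x
    _ = N := by simp

theorem half_le_measureReal_pi_forall_notMem [MeasurableSpace Ω] {μ : Measure Ω}
    [IsProbabilityMeasure μ] {A : Set Ω} (hA : MeasurableSet A)
    (hμA : Fintype.card ι * μ.real A ≤ 1 / 2) :
    1 / 2 ≤ (Measure.pi fun _ : ι => μ).real {y | ∀ i, y i ∉ A} := by
  have hmeas (i : ι) : MeasurableSet (Function.eval i ⁻¹' A : Set (ι → Ω)) :=
    measurable_pi_apply i hA
  have hcompl : {y : ι → Ω | ∀ i, y i ∉ A} = (⋃ i, Function.eval i ⁻¹' A)ᶜ := by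
    ext y
    simp
  have hunion : (Measure.pi fun _ : ι => μ).real (⋃ i, Function.eval i ⁻¹' A) ≤ 1 / 2 := by
    refine (measureReal_iUnion_fintype_le _).trans (le_trans ?_ hμA)
    simp [(measurePreserving_eval (fun _ : ι => μ) _).measureReal_preimage hA.nullMeasurableSet]
  rw [hcompl, probReal_compl_eq_one_sub (MeasurableSet.iUnion hmeas)]
  linarith

theorem mul_measure_le_measure_prod {α β : Type*} [MeasurableSpace α] [MeasurableSpace β]
    (μ : Measure α) {ν : Measure β} [SFinite ν] {B : Set α} {E : Set (α × β)}
    (hE : MeasurableSet E) {a : ℝ≥0∞} (hB : ∀ x ∈ B, a ≤ ν (Prod.mk x ⁻¹' E)) :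
    a * μ B ≤ (μ.prod ν) E := by
  rw [Measure.prod_apply hE]
  exact (mul_le_mul_right (measure_mono hB) a).trans
    (mul_meas_ge_le_lintegral (measurable_measure_prodMk_left hE) a)

variable [TopologicalSpace Ω] [MeasurableSpace Ω] [OpensMeasurableSpace Ω] {Φ : Set (Ω → ℝ)}
  {K : ℕ}

/-- The samples for which at least `p` points lie in a set `{ω | 0 ≤ φ ω}`, `φ ∈ Φ`, in which
at most half a point is expected. -/
def crowdedSamples (μ : Measure Ω) (Φ : Set (Ω → ℝ)) (p : ℕ) : Set (ι → Ω) :=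
  {x | ∃ φ ∈ Φ, Fintype.card ι * μ.real {ω | 0 ≤ φ ω} ≤ 1 / 2 ∧
    ∃ s : Finset ι, p ≤ s.card ∧ ∀ i ∈ s, 0 ≤ φ (x i)}

theorem half_le_measureReal_discrepantPairs_of_mem_crowdedSamples {μ : Measure Ω}
    [IsProbabilityMeasure μ] (hΦ : ∀ φ ∈ Φ, Continuous φ) {p : ℕ} {x : ι → Ω}
    (hx : x ∈ crowdedSamples μ Φ p) :
    1 / 2 ≤ (Measure.pi fun _ : ι => μ).real {y | (fun i => (x i, y i)) ∈ discrepantPairs Φ p} := by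
  obtain ⟨φ, hφ, hμφ, s, hps, hs⟩ := hx
  have hmeas : MeasurableSet {ω | 0 ≤ φ ω} :=
    measurableSet_le measurable_const (hΦ φ hφ).measurable
  refine (half_le_measureReal_pi_forall_notMem hmeas hμφ).trans (measureReal_mono fun y hy => ?_)
  obtain ⟨c, hc, hyc⟩ := exists_lt_zero_forall_lt fun i => not_le.1 (hy i)
  exact ⟨φ, hφ, c, ⟨s, hps, fun i hi => hc.trans_le (hs i hi)⟩, hyc⟩

variable [SecondCountableTopology Ω]

theorem measureReal_discrepantPairs_mul_two_pow_le (μ : Measure Ω) [IsProbabilityMeasure μ]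
    (hΦ : ∀ φ ∈ Φ, Continuous φ)
    (hK : ∀ z : ι × Bool → Ω, (traces (strictSuperlevelSets Φ) z).card ≤ K) (p : ℕ) :
    (Measure.pi fun _ : ι => μ.prod μ).real (discrepantPairs Φ p) * 2 ^ p ≤ K := by
  classical
  set P := Measure.pi fun _ : ι => μ.prod μ
  have hmeas : MeasurableSet (discrepantPairs (ι := ι) Φ p) :=
    (isOpen_discrepantPairs hΦ p).measurableSet
  have hswap (σ : ι → Bool) := measurePreserving_swapPairs (ι := ι) μ σ
  have hsum : 2 ^ Fintype.card ι * P.real (discrepantPairs Φ p) ≤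
      K * 2 ^ Fintype.card ι / 2 ^ p := by
    calc 2 ^ Fintype.card ι * P.real (discrepantPairs Φ p)
        = ∑ σ : ι → Bool, P.real (swapPairs σ ⁻¹' discrepantPairs Φ p) := by
          simp [P, (hswap _).measureReal_preimage hmeas.nullMeasurableSet]
      _ ≤ _ := by
          refine sum_measureReal_le_of_card_le (fun σ => (hswap σ).measurable hmeas) fun w => ?_
          rw [le_div_iff₀ (by positivity)]
          exact_mod_cast card_swapPairs_mem_mul_two_pow_le hK p w
  rw [le_div_iff₀ (by positivity)] at hsum
  refine le_of_mul_le_mul_left (le_of_eq_of_le ?_ (hsum.trans_eq (mul_comm _ _)))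
    (pow_pos (two_pos (α := ℝ)) (Fintype.card ι))
  ring

/-- An independent second sample has no point in the crowded set with probability at least `1 / 2`,
and exchanging points between the two samples makes such a discrepancy rare. -/
theorem measureReal_crowdedSamples_mul_two_pow_le (μ : Measure Ω) [IsProbabilityMeasure μ]
    (hΦ : ∀ φ ∈ Φ, Continuous φ)
    (hK : ∀ z : ι × Bool → Ω, (traces (strictSuperlevelSets Φ) z).card ≤ K) (p : ℕ) :
    (Measure.pi fun _ : ι => μ).real (crowdedSamples μ Φ p) * 2 ^ p ≤ 2 * K := by
  set ν := Measure.pi fun _ : ι => μ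
  set E : Set ((ι → Ω) × (ι → Ω)) := {q | (fun i => (q.1 i, q.2 i)) ∈ discrepantPairs Φ p}
  have he := (measurePreserving_arrowProdEquivProdArrow Ω Ω ι (fun _ => μ) (fun _ => μ)).symm
  have hopen := isOpen_discrepantPairs (ι := ι) hΦ p
  have hE : MeasurableSet E := he.measurable hopen.measurableSet
  have hνE : (ν.prod ν).real E =
      (Measure.pi fun _ : ι => μ.prod μ).real (discrepantPairs Φ p) :=
    he.measureReal_preimage hopen.measurableSet.nullMeasurableSet
  have hmarkov := mul_measure_le_measure_prod ν (B := crowdedSamples μ Φ p) (a := 1 / 2) hE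
    fun x hx => by
      have hslice : 1 / 2 ≤ ν.real (Prod.mk x ⁻¹' E) :=
        half_le_measureReal_discrepantPairs_of_mem_crowdedSamples hΦ hx
      simpa using ENNReal.ofReal_le_of_le_toReal hslice
  have hmarkov' : 1 / 2 * ν.real (crowdedSamples μ Φ p) ≤ (ν.prod ν).real E := by
    simpa [measureReal_def] using ENNReal.toReal_mono (measure_ne_top _ _) hmarkov
  calc ν.real (crowdedSamples μ Φ p) * 2 ^ p
      = 2 * (1 / 2 * ν.real (crowdedSamples μ Φ p) * 2 ^ p) := by ring
    _ ≤ 2 * ((ν.prod ν).real E * 2 ^ p) := by gcongr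
    _ ≤ 2 * K := by
        rw [hνE]
        gcongr
        exact measureReal_discrepantPairs_mul_two_pow_le μ hΦ hK p

end Symmetrization

section DistinctPoints

variable {Ω ι : Type*} [MeasurableSpace Ω] [MeasurableEq Ω] {μ : Measure Ω}
  [IsProbabilityMeasure μ] {b : ℝ}

theorem measureReal_prod_diagonal_le (hb : ∀ ω, μ.real {ω} ≤ b) :
    (μ.prod μ).real (diagonal Ω) ≤ b := by
  have hdiag : MeasurableSet (diagonal Ω) := measurableSet_diagonal
  have hle : (μ.prod μ) (diagonal Ω) ≤ ENNReal.ofReal b := by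
    rw [Measure.prod_apply hdiag]
    calc ∫⁻ ω, μ (Prod.mk ω ⁻¹' diagonal Ω) ∂μ ≤ ∫⁻ _, ENNReal.ofReal b ∂μ := by
          refine lintegral_mono fun ω => ?_
          have hslice : Prod.mk ω ⁻¹' diagonal Ω = {ω} := by
            ext
            simp [eq_comm]
          rw [hslice, ← ofReal_measureReal]
          exact ENNReal.ofReal_le_ofReal (hb ω)
      _ = ENNReal.ofReal b := by simp
  have hb₀ : 0 ≤ b :=
    let ⟨ω⟩ := nonempty_of_isProbabilityMeasure μ
    measureReal_nonneg.trans (hb ω)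
  exact ENNReal.toReal_le_of_le_ofReal hb₀ hle

variable [Fintype ι]

theorem measureReal_pi_eq_eval_le (hb : ∀ ω, μ.real {ω} ≤ b) {i j : ι} (hij : i ≠ j) :
    (Measure.pi fun _ : ι => μ).real {x | x i = x j} ≤ b := by
  set ν := Measure.pi fun _ : ι => μ
  have hindep : ProbabilityTheory.IndepFun (fun x : ι → Ω => x i) (fun x => x j) ν :=
    (ProbabilityTheory.iIndepFun_pi (μ := fun _ : ι => μ) (X := fun _ => id)
      fun _ => aemeasurable_id).indepFun hij
  have hmap := (ProbabilityTheory.indepFun_iff_map_prod_eq_prod_map_map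
    (measurable_pi_apply i).aemeasurable (measurable_pi_apply j).aemeasurable).1 hindep
  have heval (k : ι) : ν.map (fun x => x k) = μ :=
    (measurePreserving_eval (fun _ : ι => μ) k).map_eq
  rw [heval, heval] at hmap
  calc ν.real {x | x i = x j} = (μ.prod μ).real (diagonal Ω) := by
        rw [← hmap, map_measureReal_apply (by fun_prop) measurableSet_diagonal]
        rfl
    _ ≤ b := measureReal_prod_diagonal_le hb

theorem measureReal_pi_not_injective_le (hb : ∀ ω, μ.real {ω} ≤ b) :
    (Measure.pi fun _ : ι => μ).real {x | ¬ Function.Injective x} ≤ Fintype.card ι ^ 2 * b := by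
  set ν := Measure.pi fun _ : ι => μ
  have hsub : {x : ι → Ω | ¬ Function.Injective x} ⊆
      ⋃ q : ι × ι, {x | q.1 ≠ q.2 ∧ x q.1 = x q.2} := by
    intro x hx
    obtain ⟨i, j, hxij, hij⟩ := Function.not_injective_iff.1 hx
    exact mem_iUnion.2 ⟨(i, j), hij, hxij⟩
  have hb₀ : 0 ≤ b :=
    let ⟨ω⟩ := nonempty_of_isProbabilityMeasure μ
    measureReal_nonneg.trans (hb ω)
  calc ν.real {x | ¬ Function.Injective x}
      ≤ ∑ q : ι × ι, ν.real {x | q.1 ≠ q.2 ∧ x q.1 = x q.2} :=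
        (measureReal_mono hsub).trans (measureReal_iUnion_fintype_le _)
    _ ≤ ∑ _q : ι × ι, b := by
        refine Finset.sum_le_sum fun q _ => ?_
        by_cases hq : q.1 = q.2
        · simpa [hq] using hb₀
        · simpa [hq] using measureReal_pi_eq_eval_le hb hq
    _ = Fintype.card ι ^ 2 * b := by simp [sq, Fintype.card_prod]

end DistinctPoints

section LipschitzPart

variable {Ω : Type*}

theorem vcDim_mono {𝒜 ℬ : Set (Set Ω)} (h : 𝒜 ⊆ ℬ) : vcDim 𝒜 ≤ vcDim ℬ :=
  iSup_mono fun _ => iSup_mono' fun hB =>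
    ⟨fun C hC => let ⟨A, hA, hAC⟩ := hB C hC; ⟨A, h hA, hAC⟩, le_rfl⟩

theorem superlevelSets_mono {F G : Set (Ω → ℝ)} (h : F ⊆ G) :
    superlevelSets F ⊆ superlevelSets G :=
  fun _ ⟨f, hf, hS⟩ => ⟨f, h hf, hS⟩

theorem IndexTree.admissible_sep_lipschitzWith_iff [MetricSpace Ω] {F : Set (Ω → ℝ)}
    {T : IndexTree Ω} : T.Admissible {f ∈ F | LipschitzWith 1 f} ↔ T.Admissible F := by
  induction T with
  | leaf => rfl
  | node _ _ _ _ ihneg ihpos =>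
      simp only [Admissible, ihneg, ihpos, mem_ofPred, and_assoc, and_self_left]

theorem IndexTree.isMetricTree_sep_lipschitzWith_iff [MetricSpace Ω] {F : Set (Ω → ℝ)}
    {T : IndexTree Ω} : T.IsMetricTree {f ∈ F | LipschitzWith 1 f} ↔ T.IsMetricTree F :=
  and_congr_right' admissible_sep_lipschitzWith_iff

end LipschitzPart

section FixedDimension

variable {Ω ι : Type*} [Fintype ι]

theorem ncard_range_inter_eq_card_filter {x : ι → Ω} (hx : Function.Injective x)
    (A : Set Ω) [DecidablePred fun i => x i ∈ A] :
    (range x ∩ A).ncard = (Finset.univ.filter fun i => x i ∈ A).card := by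
  rw [← image_preimage_eq_range_inter, ncard_image_of_injective _ hx, ← ncard_coe_finset]
  congr 1
  ext i
  simp

variable [MetricSpace Ω] [MeasurableSpace Ω] {μ : Measure Ω}

theorem measureReal_thickening_le_ncard_mul {X : Set Ω} (hX : X.Finite) {r b : ℝ}
    (hball : ∀ ω, μ.real (Metric.ball ω r) ≤ b) :
    μ.real (Metric.thickening r X) ≤ X.ncard * b := by
  have hunion : Metric.thickening r X = ⋃ ω ∈ hX.toFinset, Metric.ball ω r := by
    simp [Metric.thickening_eq_biUnion_ball]
  calc μ.real (Metric.thickening r X) ≤ ∑ ω ∈ hX.toFinset, μ.real (Metric.ball ω r) := by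
        rw [hunion]
        exact measureReal_biUnion_finset_le _ _
    _ ≤ ∑ _ω ∈ hX.toFinset, b := Finset.sum_le_sum fun ω _ => hball ω
    _ = X.ncard * b := by rw [Finset.sum_const, nsmul_eq_mul, ncard_eq_toFinset_card X hX]

variable [OpensMeasurableSpace Ω] [IsProbabilityMeasure μ] {F : Set (Ω → ℝ)} {δ : ℝ}
  {p Q : ℕ}

theorem half_le_measureReal_thickening_diff {X A : Set Ω} (hX : X.Finite) (hδ : 0 < δ)
    (hball : ∀ ω, μ.real (Metric.ball ω (2 * δ)) ≤ concentrationFunction μ δ)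
    (hα : (X.ncard + 1) * concentrationFunction μ δ ≤ 1 / 2)
    (hA : concentrationFunction μ δ < μ.real A) :
    1 / 2 ≤ μ.real (Metric.thickening (2 * δ) A \ Metric.thickening (2 * δ) X) := by
  have hfat := one_sub_concentrationFunction_le_measureReal_thickening_two_mul hδ hA
  have hcover := measureReal_thickening_le_ncard_mul hX hball
  have hdiff : μ.real (Metric.thickening (2 * δ) A) - μ.real (Metric.thickening (2 * δ) X) ≤
      μ.real (Metric.thickening (2 * δ) A \ Metric.thickening (2 * δ) X) :=
    le_measureReal_sdiff
  linarith

theorem natCast_le_avgNNCost_of_notMem_crowdedSamples (hδ : 0 < δ)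
    (hball : ∀ ω, μ.real (Metric.ball ω (2 * δ)) ≤ concentrationFunction μ δ)
    (hα : (Fintype.card ι + 1) * concentrationFunction μ δ ≤ 1 / 2)
    (hpQ : p + (p + 1) * (2 * Q) < Fintype.card ι) {x : ι → Ω} (hinj : Function.Injective x)
    (hx : x ∉ crowdedSamples μ (cellFunctions F (2 * Q)) (p + 1)) {T : IndexTree Ω}
    (hT : T.IsMetricTree F) : (Q : ℝ≥0∞) ≤ T.avgNNCost μ (range x) := by
  classical
  have hncard : (range x).ncard = Fintype.card ι := by
    rw [← Nat.card_coe_set_eq, Nat.card_range_of_injective hinj, Nat.card_eq_fintype_card]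
  refine IndexTree.natCast_le_avgNNCost (finite_range x) (ε := 2 * δ) (p := p)
    (fun φ hφ hcard => ?_) (by rwa [hncard]) hT
  rw [ncard_range_inter_eq_card_filter hinj] at hcard
  have hlarge : 1 / 2 < Fintype.card ι * μ.real {ω | 0 ≤ φ ω} := by
    by_contra! hle
    exact hx ⟨φ, hφ, hle, _, hcard, by simp⟩
  have hA : concentrationFunction μ δ < μ.real {ω | 0 ≤ φ ω} := by
    nlinarith [measureReal_nonneg (μ := μ) (s := {ω | 0 ≤ φ ω})]
  have hhalf := half_le_measureReal_thickening_diff (finite_range x) hδ hball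
    (by rwa [hncard]) hA
  simpa using ENNReal.ofReal_le_of_le_toReal hhalf

theorem measureReal_pi_exists_avgNNCost_lt_le [SecondCountableTopology Ω]
    {D : ℕ} (hD : vcDim (superlevelSets F) ≤ D) (hδ : 0 < δ)
    (hball : ∀ ω, μ.real (Metric.ball ω (2 * δ)) ≤ concentrationFunction μ δ)
    (hα : (Fintype.card ι + 1) * concentrationFunction μ δ ≤ 1 / 2)
    (hpQ : p + (p + 1) * (2 * Q) < Fintype.card ι) :
    (Measure.pi fun _ : ι => μ).real {x | ¬ ∀ T : IndexTree Ω, T.IsMetricTree F →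
      (Q : ℝ≥0∞) ≤ T.avgNNCost μ (range x)} ≤
    Fintype.card ι ^ 2 * concentrationFunction μ δ +
      4 * (2 * (2 * Fintype.card ι + 1) ^ D + 1) ^ (2 * Q) / 2 ^ (p + 1) := by
  set ν := Measure.pi fun _ : ι => μ
  set G := {f ∈ F | LipschitzWith 1 f}
  have hG : vcDim (superlevelSets G) ≤ D :=
    (vcDim_mono (superlevelSets_mono (sep_subset F _))).trans hD
  set crowded : Set (ι → Ω) := crowdedSamples μ (cellFunctions G (2 * Q)) (p + 1)
  have hcrowded : ν.real crowded ≤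
      4 * (2 * (2 * Fintype.card ι + 1) ^ D + 1) ^ (2 * Q) / 2 ^ (p + 1) := by
    rw [le_div_iff₀ (by positivity)]
    refine (measureReal_crowdedSamples_mul_two_pow_le μ
      (fun φ hφ => continuous_of_mem_cellFunctions (fun f hf => hf.2.continuous) hφ)
      (fun z => card_traces_strictSuperlevelSets_cellFunctions_le hG z (2 * Q))
      (p + 1)).trans_eq ?_
    simp only [Fintype.card_prod, Fintype.card_bool]
    push_cast
    ring
  have hrepeated : ν.real {x | ¬ Function.Injective x} ≤
      Fintype.card ι ^ 2 * concentrationFunction μ δ :=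
    measureReal_pi_not_injective_le fun ω => (measureReal_mono
      (singleton_subset_iff.2 (Metric.mem_ball_self (by positivity)))).trans (hball ω)
  refine (measureReal_mono fun x hx => ?_).trans
    ((measureReal_union_le {x | ¬ Function.Injective x} crowded).trans
      (add_le_add hrepeated hcrowded))
  by_contra hgood
  obtain ⟨hinj, hcrowd⟩ := not_or.1 hgood
  exact hx fun T hT => natCast_le_avgNNCost_of_notMem_crowdedSamples hδ hball hα hpQ
    (not_not.1 hinj) hcrowd (IndexTree.isMetricTree_sep_lipschitzWith_iff.2 hT)

end FixedDimension

section Asymptotics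

theorem eventually_natCast_le_exp_mul {n : ℕ → ℕ}
    (hn : (fun d : ℕ => Real.log (n d)) =o[atTop] (fun d : ℕ => (d : ℝ))) {s : ℝ} (hs : 0 < s) :
    ∀ᶠ d : ℕ in atTop, (n d : ℝ) ≤ Real.exp (s * d) := by
  filter_upwards [hn.bound hs] with d hd
  rw [Real.norm_natCast] at hd
  rcases (n d).eq_zero_or_pos with h₀ | hpos
  · simpa [h₀] using (Real.exp_pos _).le
  · exact (Real.log_le_iff_le_exp (by exact_mod_cast hpos)).1 ((le_abs_self _).trans hd)

theorem eventually_le_two_pow {n : ℕ → ℕ}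
    (hn : (fun d : ℕ => Real.log (n d)) =o[atTop] (fun d : ℕ => (d : ℝ))) :
    ∀ᶠ d : ℕ in atTop, n d ≤ 2 ^ d := by
  filter_upwards [eventually_natCast_le_exp_mul hn (Real.log_pos one_lt_two)] with d hd
  rw [mul_comm, Real.exp_nat_mul, Real.exp_log two_pos] at hd
  exact_mod_cast hd

theorem eventually_sq_mul_exp_le {n : ℕ → ℕ}
    (hn : (fun d : ℕ => Real.log (n d)) =o[atTop] (fun d : ℕ => (d : ℝ))) {C a : ℝ}
    (hC : 0 < C) (ha : 0 < a) :
    ∀ᶠ d : ℕ in atTop, (n d : ℝ) ^ 2 * (C * Real.exp (-(a * d))) ≤ 1 / (2 * d ^ 2) := by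
  have hpoly : ∀ᶠ d : ℕ in atTop, ‖(d : ℝ) ^ 2‖ ≤ 1 / (2 * C) * ‖Real.exp (a / 2 * d)‖ :=
    ((isLittleO_pow_exp_pos_mul_atTop 2 (half_pos ha)).comp_tendsto
      tendsto_natCast_atTop_atTop).bound (by positivity)
  filter_upwards [eventually_natCast_le_exp_mul hn (s := a / 4) (by positivity), hpoly,
    eventually_gt_atTop 0] with d hnd hpoly hd
  rw [Real.norm_of_nonneg (by positivity), Real.norm_of_nonneg (by positivity)] at hpoly
  have hcancel : Real.exp (a / 4 * d) ^ 2 * Real.exp (-(a * d)) * Real.exp (a / 2 * d) = 1 := by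
    rw [← Real.exp_nat_mul, ← Real.exp_add, ← Real.exp_add, Real.exp_eq_one_iff]
    push_cast
    ring
  rw [le_div_iff₀ (by positivity)]
  calc (n d : ℝ) ^ 2 * (C * Real.exp (-(a * d))) * (2 * d ^ 2)
      ≤ Real.exp (a / 4 * d) ^ 2 * (C * Real.exp (-(a * d))) *
        (2 * (1 / (2 * C) * Real.exp (a / 2 * d))) := by gcongr
    _ = Real.exp (a / 4 * d) ^ 2 * Real.exp (-(a * d)) * Real.exp (a / 2 * d) := by field_simp
    _ = 1 := hcancel

theorem eventually_mul_sqrt_div_le (C : ℝ) {c b : ℝ} (hc : 0 < c) (hb : 0 < b) :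
    ∀ᶠ d : ℕ in atTop, C * (√(Real.pi / (c * d)) / 2) ≤ b := by
  have harg : Tendsto (fun d : ℕ => Real.pi / (c * d)) atTop (𝓝 0) :=
    tendsto_const_nhds.div_atTop (tendsto_natCast_atTop_atTop.const_mul_atTop hc)
  have hlim := ((Real.continuous_sqrt.tendsto 0).comp harg).div_const 2 |>.const_mul C
  simp only [Real.sqrt_zero, zero_div, mul_zero] at hlim
  exact hlim.eventually_le_const hb

theorem two_mul_pow_add_one_pow_le {n d : ℕ} (hn : n ≤ 2 ^ d) (D m : ℕ) :
    (2 * (2 * n + 1) ^ D + 1) ^ m ≤ 2 ^ (((d + 2) * D + 2) * m) := by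
  have hbase : 2 * n + 1 ≤ 2 ^ (d + 2) := by
    have := Nat.one_le_two_pow (n := d)
    rw [pow_add]
    omega
  have hone : 1 ≤ 2 ^ ((d + 2) * D) := Nat.one_le_two_pow
  rw [pow_mul 2]
  gcongr
  calc 2 * (2 * n + 1) ^ D + 1 ≤ 2 * (2 ^ (d + 2)) ^ D + 1 := by gcongr
    _ ≤ 2 ^ ((d + 2) * D + 2) := by
        rw [← pow_mul, pow_add]
        omega

theorem eight_mul_sq_mul_two_mul_pow_add_one_pow_le {n d : ℕ} (hd : 4 ≤ d) (hn : n ≤ 2 ^ d)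
    (k K : ℕ) : 8 * d ^ 2 * (2 * (2 * n + 1) ^ d ^ K + 1) ^ (2 * d ^ k) ≤
      2 ^ (d ^ (k + K + 3) + 1) := by
  have hsq : 8 * d ^ 2 ≤ 2 ^ (3 + 2 * d) := by
    have hlt : d < 2 ^ d := Nat.lt_two_pow_self
    calc 8 * d ^ 2 ≤ 8 * (2 ^ d) ^ 2 := by gcongr
      _ = 2 ^ (3 + 2 * d) := by rw [pow_add, mul_comm 2 d, pow_mul]; norm_num
  have hexp : 3 + 2 * d + ((d + 2) * d ^ K + 2) * (2 * d ^ k) ≤ d ^ (k + K + 3) := by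
    have hk : d ^ k ≤ d ^ k * d ^ K := Nat.le_mul_of_pos_right _ (by positivity)
    have hone : 1 ≤ d ^ k * d ^ K := Nat.one_le_iff_ne_zero.2 (by positivity)
    have hcube : 4 * d + 11 ≤ d ^ 3 := by nlinarith
    calc 3 + 2 * d + ((d + 2) * d ^ K + 2) * (2 * d ^ k)
        = (3 + 2 * d) * 1 + (2 * d + 4) * (d ^ k * d ^ K) + 4 * d ^ k := by ring
      _ ≤ (3 + 2 * d) * (d ^ k * d ^ K) + (2 * d + 4) * (d ^ k * d ^ K) +
          4 * (d ^ k * d ^ K) := by gcongr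
      _ = d ^ k * d ^ K * (4 * d + 11) := by ring
      _ ≤ d ^ k * d ^ K * d ^ 3 := by gcongr
      _ = d ^ (k + K + 3) := by rw [pow_add, pow_add]
  calc 8 * d ^ 2 * (2 * (2 * n + 1) ^ d ^ K + 1) ^ (2 * d ^ k)
      ≤ 2 ^ (3 + 2 * d) * 2 ^ (((d + 2) * d ^ K + 2) * (2 * d ^ k)) :=
        Nat.mul_le_mul hsq (two_mul_pow_add_one_pow_le hn _ _)
    _ = 2 ^ (3 + 2 * d + ((d + 2) * d ^ K + 2) * (2 * d ^ k)) := (pow_add _ _ _).symm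
    _ ≤ 2 ^ (d ^ (k + K + 3) + 1) := Nat.pow_le_pow_right two_pos (by omega)

theorem add_mul_two_mul_pow_lt {d : ℕ} (hd : 6 ≤ d) (k l : ℕ) :
    d ^ l + (d ^ l + 1) * (2 * d ^ k) < d ^ (k + l + 1) := by
  have hk : 1 ≤ d ^ k := Nat.one_le_pow _ _ (by omega)
  have hl : 1 ≤ d ^ l := Nat.one_le_pow _ _ (by omega)
  calc d ^ l + (d ^ l + 1) * (2 * d ^ k)
      ≤ d ^ l * d ^ k + (d ^ l + d ^ l) * (2 * d ^ k) := by
        gcongr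
        exact Nat.le_mul_of_pos_right _ hk
    _ = d ^ k * d ^ l * 5 := by ring
    _ < d ^ k * d ^ l * d := by gcongr; omega
    _ = d ^ (k + l + 1) := by rw [pow_succ, pow_add]

theorem add_one_mul_le_half {n d : ℕ} {b : ℝ} (hn : 1 ≤ n) (hd : 2 ≤ d)
    (hb : (n : ℝ) ^ 2 * b ≤ 1 / (2 * d ^ 2)) : (n + 1) * b ≤ 1 / 2 := by
  rcases le_total b 0 with hneg | hpos
  · exact (mul_nonpos_of_nonneg_of_nonpos (by positivity) hneg).trans one_half_pos.le
  have hn' : (1 : ℝ) ≤ n := by exact_mod_cast hn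
  have hd' : (2 : ℝ) ≤ d := by exact_mod_cast hd
  calc (n + 1) * b ≤ 2 * n ^ 2 * b := by gcongr; nlinarith
    _ = 2 * (n ^ 2 * b) := mul_assoc _ _ _
    _ ≤ 2 * (1 / (2 * 2 ^ 2)) := by
        gcongr
        exact hb.trans (by gcongr)
    _ ≤ 1 / 2 := by norm_num

theorem exists_tendsto_atTop_of_forall_eventually {P : ℕ → ℕ → Prop}
    (hP : ∀ k, ∀ᶠ d in atTop, P k d) :
    ∃ h : ℕ → ℕ, Tendsto h atTop atTop ∧ ∀ᶠ d in atTop, P (h d) d := by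
  classical
  choose N hN using fun k => eventually_atTop.1 (hP k)
  refine ⟨fun d => Nat.findGreatest (fun k => N k ≤ d) d, ?_, ?_⟩
  · refine tendsto_atTop.2 fun k => ?_
    filter_upwards [eventually_ge_atTop k, eventually_ge_atTop (N k)] with d hk hNk
    exact Nat.le_findGreatest hk hNk
  · filter_upwards [eventually_ge_atTop (N 0)] with d hd
    exact hN _ _ (Nat.findGreatest_spec (P := fun k => N k ≤ d) (Nat.zero_le d) hd)

theorem ae_infinitePi_eventually_notMem {E : ℕ → Type*} [∀ d, MeasurableSpace (E d)]
    (ν : ∀ d, Measure (E d)) [∀ d, IsProbabilityMeasure (ν d)] {S : ∀ d, Set (E d)} {u : ℕ → ℝ}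
    (hu : Summable u) (hS : ∀ᶠ d in atTop, (ν d).real (S d) ≤ u d) :
    ∀ᵐ x ∂(Measure.infinitePi ν), ∀ᶠ d in atTop, x d ∉ S d := by
  obtain ⟨N, hN⟩ := eventually_atTop.1 hS
  have htail : ∀ᵐ x ∂(Measure.infinitePi ν), ∀ᶠ d in atTop, x (d + N) ∉ S (d + N) := by
    refine ae_eventually_notMem (s := fun d => Function.eval (d + N) ⁻¹' S (d + N))
      (ne_top_of_le_ne_top ((summable_nat_add_iff N).2 hu).tsum_ofReal_ne_top
        (ENNReal.tsum_le_tsum fun d => ?_))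
    calc Measure.infinitePi ν (Function.eval (d + N) ⁻¹' S (d + N))
        ≤ ν (d + N) (S (d + N)) :=
          (measurePreserving_eval_infinitePi ν (d + N)).measure_preimage_le _
      _ ≤ ENNReal.ofReal (u (d + N)) := by
          rw [← ofReal_measureReal]
          exact ENNReal.ofReal_le_ofReal (hN _ (Nat.le_add_left N d))
  filter_upwards [htail] with x hx
  rwa [← map_add_atTop_eq_nat N, eventually_map]

end Asymptotics

section GrowingDimension

theorem HasGaussianConcentration.measureReal_ball_le_concentrationFunction {Ω : Type*}
    [MetricSpace Ω] [SecondCountableTopology Ω] [MeasurableSpace Ω] [OpensMeasurableSpace Ω]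
    {μ : Measure Ω} [IsProbabilityMeasure μ] {C a m : ℝ} (h : HasGaussianConcentration μ C a)
    (ha : 0 < a) (hm : 0 < m) (hdist : m ≤ ∫ p, dist p.1 p.2 ∂(μ.prod μ))
    (hsmall : C * (√(Real.pi / a) / 2) ≤ m / 8) (ω : Ω) :
    μ.real (Metric.ball ω (2 * (m / 16))) ≤ concentrationFunction μ (m / 16) := by
  refine SimSearch.measureReal_ball_le_concentrationFunction (by positivity) ?_ ω
  have hmean : ENNReal.ofReal m ≤ ∫⁻ p, edist p.1 p.2 ∂(μ.prod μ) := by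
    rw [integral_eq_lintegral_of_nonneg_ae (Eventually.of_forall fun p => dist_nonneg)
      (by fun_prop)] at hdist
    simpa only [edist_dist] using ENNReal.ofReal_le_of_le_toReal hdist
  calc 2 * (ENNReal.ofReal (2 * (m / 16) + m / 16) +
        ∫⁻ t in Ioi 0, ENNReal.ofReal (concentrationFunction μ t))
      ≤ 2 * (ENNReal.ofReal (3 * m / 16) + ENNReal.ofReal (m / 8)) := by
        gcongr
        · linarith
        · exact (h.lintegral_concentrationFunction_le ha).trans (ENNReal.ofReal_le_ofReal hsmall)
    _ = ENNReal.ofReal (5 * m / 8) := by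
        rw [← ENNReal.ofReal_add (by positivity) (by positivity), two_mul,
          ← ENNReal.ofReal_add (by positivity) (by positivity)]
        congr 1
        ring
    _ < ENNReal.ofReal m := (ENNReal.ofReal_lt_ofReal_iff hm).2 (by linarith)
    _ ≤ _ := hmean

/-- The choice `p = d ^ (k + K + 3)` outweighs the number of traces of the cells and still leaves
`p * d ^ k` negligible against `n`. -/
theorem measureReal_pi_exists_avgNNCost_lt_pow_le {Ω : Type*} [MetricSpace Ω]
    [SecondCountableTopology Ω] [MeasurableSpace Ω] [OpensMeasurableSpace Ω] {μ : Measure Ω}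
    [IsProbabilityMeasure μ] {F : Set (Ω → ℝ)} {d k K n : ℕ}
    (hVC : vcDim (superlevelSets F) ≤ ((d ^ K : ℕ) : ℕ∞)) (hd : 6 ≤ d) (hn : n ≤ 2 ^ d)
    (hdn : d ^ (k + (k + K + 3) + 1) ≤ n) {δ : ℝ} (hδ : 0 < δ)
    (hball : ∀ ω, μ.real (Metric.ball ω (2 * δ)) ≤ concentrationFunction μ δ)
    (hα : (n : ℝ) ^ 2 * concentrationFunction μ δ ≤ 1 / (2 * d ^ 2)) :
    (Measure.pi fun _ : Fin n => μ).real {x | ¬ ∀ T : IndexTree Ω, T.IsMetricTree F →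
      (d : ℝ≥0∞) ^ k ≤ T.avgNNCost μ (range x)} ≤ 1 / d ^ 2 := by
  have hn₁ : 1 ≤ n := (Nat.one_le_pow _ _ (by omega)).trans hdn
  have hmain := measureReal_pi_exists_avgNNCost_lt_le (ι := Fin n) (p := d ^ (k + K + 3))
    (Q := d ^ k) hVC hδ hball
    (by simpa only [Fintype.card_fin] using add_one_mul_le_half hn₁ (by omega) hα)
    (by simpa only [Fintype.card_fin] using (add_mul_two_mul_pow_lt hd k _).trans_le hdn)
  have htraces : (8 : ℝ) * d ^ 2 * (2 * (2 * n + 1) ^ d ^ K + 1) ^ (2 * d ^ k) ≤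
      2 ^ (d ^ (k + K + 3) + 1) := by
    exact_mod_cast eight_mul_sq_mul_two_mul_pow_add_one_pow_le (by omega) hn k K
  simp only [Fintype.card_fin, Nat.cast_pow] at hmain
  calc _ ≤ _ := hmain
    _ ≤ 1 / (2 * (d : ℝ) ^ 2) + 1 / (2 * d ^ 2) := by
        refine add_le_add hα ?_
        rw [div_le_div_iff₀ (by positivity) (by positivity)]
        linarith
    _ = 1 / d ^ 2 := by
        field_simp
        norm_num

theorem eventually_measureReal_pi_exists_avgNNCost_lt_pow_le {Ω : ℕ → Type*}
    [∀ d, MetricSpace (Ω d)] [∀ d, SecondCountableTopology (Ω d)] [∀ d, MeasurableSpace (Ω d)]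
    [∀ d, OpensMeasurableSpace (Ω d)] {μ : ∀ d, Measure (Ω d)} [∀ d, IsProbabilityMeasure (μ d)]
    {C c m : ℝ} (hc : 0 < c)
    (hconc : ∀ᶠ d : ℕ in atTop, HasGaussianConcentration (μ d) C (c * d)) (hm : 0 < m)
    (hdist : ∀ᶠ d in atTop, m ≤ ∫ p, dist p.1 p.2 ∂((μ d).prod (μ d)))
    {F : ∀ d, Set (Ω d → ℝ)} {K : ℕ}
    (hVC : ∀ᶠ d : ℕ in atTop, vcDim (superlevelSets (F d)) ≤ ((d ^ K : ℕ) : ℕ∞))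
    {n : ℕ → ℕ} (hsuper : ∀ k : ℕ, ∀ᶠ d : ℕ in atTop, d ^ k ≤ n d)
    (hsub : (fun d : ℕ => Real.log (n d)) =o[atTop] (fun d : ℕ => (d : ℝ))) (k : ℕ) :
    ∀ᶠ d : ℕ in atTop, (Measure.pi fun _ : Fin (n d) => μ d).real
      {x | ¬ ∀ T : IndexTree (Ω d), T.IsMetricTree (F d) →
        (d : ℝ≥0∞) ^ k ≤ T.avgNNCost (μ d) (range x)} ≤ 1 / d ^ 2 := by
  obtain ⟨d₀, hd₀⟩ := hconc.exists
  have hC : 0 < C := one_half_pos.trans_le hd₀.half_le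
  filter_upwards [hconc, hdist, hVC, hsuper (k + (k + K + 3) + 1), eventually_le_two_pow hsub,
    eventually_sq_mul_exp_le hsub hC (a := c * (m / 16) ^ 2) (by positivity),
    eventually_mul_sqrt_div_le C hc (b := m / 8) (by positivity), eventually_ge_atTop 6]
    with d hconc hdist hVC hdn hn hexp hsmall hd
  have hball := hconc.measureReal_ball_le_concentrationFunction (by positivity) hm hdist hsmall
  refine measureReal_pi_exists_avgNNCost_lt_pow_le hVC hd hn hdn (by positivity) hball
    (le_trans ?_ hexp)
  gcongr
  exact (hconc (m / 16) (by positivity)).trans_eq (by ring_nf)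

end GrowingDimension
end SimSearch

theorem mainTheorem1_general
    (Ω : ℕ → Type*) [∀ d, MetricSpace (Ω d)] [∀ d, TopologicalSpace.SeparableSpace (Ω d)]
    [∀ d, MeasurableSpace (Ω d)] [∀ d, OpensMeasurableSpace (Ω d)]
    (μ : ∀ d, Measure (Ω d)) [∀ d, IsProbabilityMeasure (μ d)]
    (hconc : ∃ C c : ℝ, 0 < c ∧ ∀ᶠ d : ℕ in atTop,
      SimSearch.HasGaussianConcentration (μ d) C (c * d))
    (hdist : ∃ m : ℝ, 0 < m ∧ ∀ᶠ d : ℕ in atTop, m ≤ ∫ p, dist p.1 p.2 ∂((μ d).prod (μ d)))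
    (F : ∀ d, Set (Ω d → ℝ))
    (hVC : ∃ k : ℕ, ∀ᶠ d : ℕ in atTop,
      SimSearch.vcDim (SimSearch.superlevelSets (F d)) ≤ ((d ^ k : ℕ) : ℕ∞))
    (n : ℕ → ℕ) (hsuper : ∀ k : ℕ, ∀ᶠ d : ℕ in atTop, d ^ k ≤ n d)
    (hsub : (fun d : ℕ => Real.log (n d)) =o[atTop] (fun d : ℕ => (d : ℝ))) :
    ∃ h : ℕ → ℕ, Tendsto h atTop atTop ∧
      Tendsto (fun d : ℕ => Measure.pi (fun _ : Fin (n d) => μ d)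
        {x | ¬ ∀ T : SimSearch.IndexTree (Ω d), T.IsMetricTree (F d) →
          (d : ℝ≥0∞) ^ h d ≤ T.avgNNCost (μ d) (range x)}) atTop (𝓝 0) ∧
      ∀ᵐ x ∂(Measure.infinitePi fun d : ℕ => Measure.pi (fun _ : Fin (n d) => μ d)),
        ∀ᶠ d : ℕ in atTop, ∀ T : SimSearch.IndexTree (Ω d), T.IsMetricTree (F d) →
          (d : ℝ≥0∞) ^ h d ≤ T.avgNNCost (μ d) (range (x d)) := by
  obtain ⟨C, c, hc, hconc⟩ := hconc
  obtain ⟨m, hm, hdist⟩ := hdist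
  obtain ⟨K, hVC⟩ := hVC
  have (d : ℕ) : SecondCountableTopology (Ω d) := UniformSpace.secondCountable_of_separable _
  obtain ⟨h, hh, hbad⟩ := SimSearch.exists_tendsto_atTop_of_forall_eventually
    (SimSearch.eventually_measureReal_pi_exists_avgNNCost_lt_pow_le hc hconc hm hdist
      hVC hsuper hsub)
  have hsum : Summable fun d : ℕ => (1 : ℝ) / d ^ 2 := Real.summable_one_div_nat_pow.2 one_lt_two
  refine ⟨h, hh, ?_, ?_⟩
  · refine (ENNReal.tendsto_toReal_zero_iff fun d => measure_ne_top _ _).1 ?_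
    exact squeeze_zero' (Eventually.of_forall fun d => measureReal_nonneg) hbad
      hsum.tendsto_atTop_zero
  · filter_upwards [SimSearch.ae_infinitePi_eventually_notMem _ hsum hbad] with x hx
    exact hx.mono fun d hd => not_not.1 hd

theorem mainTheorem1
    (Ω : ℕ → Type*) [∀ d, MetricSpace (Ω d)] [∀ d, TopologicalSpace.SeparableSpace (Ω d)]
    [∀ d, MeasurableSpace (Ω d)] [∀ d, BorelSpace (Ω d)]
    (μ : ∀ d, Measure (Ω d)) [∀ d, IsProbabilityMeasure (μ d)]
    -- the concentration function is gaussian with exponent of order `ε ^ 2 * d`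
    (hconc : ∃ C c : ℝ, 0 < c ∧ ∀ᶠ d : ℕ in atTop, ∀ ε : ℝ, 0 ≤ ε →
      SimSearch.concentrationFunction (μ d) ε ≤ C * Real.exp (-(c * ε ^ 2 * d)))
    -- the expected distance between two points is `1`
    (hdist : ∀ᶠ d : ℕ in atTop, ∫ p, dist p.1 p.2 ∂((μ d).prod (μ d)) = 1)
    -- the class of decision functions
    (F : ∀ d, Set (Ω d → ℝ)) (hF : ∀ d, ∀ f ∈ F d, LipschitzWith 1 f)
    (hVC : ∃ k : ℕ, ∀ᶠ d : ℕ in atTop,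
      SimSearch.vcDim (SimSearch.superlevelSets (F d)) ≤ ((d ^ k : ℕ) : ℕ∞))
    -- the number of datapoints is superpolynomial and subexponential in `d`
    (n : ℕ → ℕ) (hsuper : ∀ k : ℕ, ∀ᶠ d : ℕ in atTop, d ^ k ≤ n d)
    (hsub : (fun d : ℕ => Real.log (n d)) =o[atTop] (fun d : ℕ => (d : ℝ))) :
    ∃ h : ℕ → ℕ, Tendsto h atTop atTop ∧
      -- the probability of a bad sample tends to `0`
      Tendsto (fun d : ℕ => Measure.pi (fun _ : Fin (n d) => μ d)
        {x | ¬ ∀ T : SimSearch.IndexTree (Ω d), T.IsMetricTree (F d) →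
          (d : ℝ≥0∞) ^ h d ≤ T.avgNNCost (μ d) (range x)}) atTop (𝓝 0) ∧
      -- almost every infinite path of independent samples is eventually good
      ∀ᵐ x ∂(Measure.infinitePi fun d : ℕ => Measure.pi (fun _ : Fin (n d) => μ d)),
        ∀ᶠ d : ℕ in atTop, ∀ T : SimSearch.IndexTree (Ω d), T.IsMetricTree (F d) →
          (d : ℝ≥0∞) ^ h d ≤ T.avgNNCost (μ d) (range (x d)) := by
  obtain ⟨C, c, hc, hgauss⟩ := hconc
  refine mainTheorem1_general Ω μ ⟨C, c, hc, hgauss.mono fun d hd ε hε => ?_⟩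
    ⟨1, one_pos, hdist.mono fun d hd => hd.ge⟩ F hVC n hsuper hsub
  simpa only [mul_right_comm] using hd ε hε
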